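/- **Conventions.** A PPT machine (PPTM) is a probabilistic Turing machine running in strictly polynomial time in the length of its input $(1^\kappa,a)$; the number of random coins it uses is a function of the security parameter $\kappa$ alone, and that number is computable (in unary) in time polynomial in $\kappa$. Write $M(1^\kappa,a;r)$ for its output when its coins are the string $r$. For $p\in[0,1]$ let $U_p$ be the distribution of a bit that equals $1$ with probability $p$; for $p=(p_1,p_2,p_3)\in[0,1]^3$ let $U_p$ be the distribution on $\{0,1\}^2$ given by $$\Pr[U_p=(x,y)]=\Pr[U_{p_1}=x]\cdot\Pr[U_{q}=y],\qquad q=p_2\text{ if }x=0,\quad q=p_3\text{ if }x=1 .$$ A *two-sided forecaster* is a PPTM $F$ that on input $(1^\kappa,t)$, $t\in\{0,1\}^*$, outputs a triplet of (rational) numbers in $[0,1]^3$. Let $Z=\{(X_\kappa,Y_\kappa,T_\kappa)\}_{\kappa\in\mathbb N}$ be an ensemble of finitely supported distributions over $\{0,1\}\times\{0,1\}\times\{0,1\}^*$, let $F$ be a two-sided forecaster, and let $R_\kappa$ be a uniform string, independent of $(X_\kappa,Y_\kappa,T_\kappa)$, whose length is the number of coins used by $F$ on security parameter $\kappa$. Put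 $$\mathrm{REAL}_\kappa=(X_\kappa,Y_\kappa,T_\kappa,R_\kappa),\qquad \mathrm{FST}_\kappa=(U_{F(1^\kappa,T_\kappa;R_\kappa)},T_\kappa,R_\kappa).$$ For $\rho>0$ and infinite $\mathcal I\subseteq\mathbb N$, the forecaster $F$ is *$(\rho,\mathcal I)$-indistinguishable with respect to $Z$* if for every PPTM $D$ with one-bit output and every sufficiently large $\kappa\in\mathcal I$, $$\bigl|\Pr[D(1^\kappa,\mathrm{REAL}_\kappa)=1]-\Pr[D(1^\kappa,\mathrm{FST}_\kappa)=1]\bigr|\le\rho .$$ **Theorem.** For every ensemble $Z$ of finitely supported distributions over $\{0,1\}\times\{0,1\}\times\{0,1\}^*$, every constant $\rho>0$ and every infinite $\mathcal I\subseteq\mathbb N$, there exist a two-sided forecaster $F$ and an infinite set $\mathcal I'\subseteq\mathcal I$ such that $F$ is $(\rho,\mathcal I')$-indistinguishable with respect to $Z$. In particular, this holds for every no-input, single-bit-output two-party protocol $\pi$, even an inefficient one (on security parameter $\kappa$ the parties toss finitely many private coins and alternately exchange a number of messages determined by $\kappa$, each message and each output bit being an arbitrary function of $\kappa$, the party's own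 coins and the messages so far), where $Z$ is the ensemble $\{(X_\kappa,Y_\kappa,T_\kappa)\}_{\kappa\in\mathbb N}$ of the two output bits and the transcript in a random execution of $\pi$. -/

import Mathlib

open scoped ENNReal

noncomputable section

/-! ### Polynomial-time computation -/

/-- The word `1^κ`. -/
def unaryWord (κ : ℕ) : List Bool := List.replicate κ true

/-- A finite sequence of binary words, written on a tape over the alphabet `{0, 1, blank}`: every
word is followed by one `blank` (here `none`). -/
def tapeOf (ws : List (List Bool)) : List (Option Bool) :=
  ws.flatMap fun w => w.map some ++ [none]

/-- `f` is computed by a deterministic multi-stack Turing machine whose number of steps is at most a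
polynomial in the length of the input tape. Inputs and outputs are presented as sequences of
binary words. -/
def PolyTimeComputable {α β : Type} (ea : α → List (List Bool)) (eb : β → List (List Bool))
    (f : α → β) : Prop :=
  Nonempty (Turing.TM2ComputableInPolyTime (fun a => tapeOf (ea a)) (fun b => tapeOf (eb b)) f)

/-- A probabilistic (strictly) polynomial-time machine which on input `(1^κ, a)` outputs an element
of `β`. On security parameter `κ` it uses `coins κ` random coins, a number that is itself
computable in time polynomial in `κ`; `run κ a r` is its output on input `(1^κ, a)` when its coins
are the string `r`. -/
structure PPTM {α β : Type} (ea : α → List (List Bool)) (eb : β → List (List Bool)) where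
  coins : ℕ → ℕ
  coins_polyTime :
    PolyTimeComputable (fun κ => [unaryWord κ]) (fun m => [unaryWord m]) coins
  run : (κ : ℕ) → α → (Fin (coins κ) → Bool) → β
  run_polyTime :
    PolyTimeComputable
      (fun x : (κ : ℕ) × (α × (Fin (coins κ) → Bool)) =>
        [unaryWord x.1] ++ ea x.2.1 ++ [List.ofFn x.2.2])
      eb (fun x => run x.1 x.2.1 x.2.2)

/-- A single bit, as a sequence consisting of one word of length one. -/
def bitWords (b : Bool) : List (List Bool) := [[b]]

/-! ### Computational indistinguishability -/

/-- The uniform distribution on `{0,1}^m`. -/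
def uniformBits (m : ℕ) : PMF (Fin m → Bool) := PMF.uniformOfFintype (Fin m → Bool)

/-- The probability, over `a ← μ` and the coins of `D`, that `D(1^κ, a) = 1`. -/
def acceptProb {α : Type} {ea : α → List (List Bool)} (D : PPTM ea bitWords) (κ : ℕ)
    (μ : PMF α) : ℝ :=
  ((μ.bind fun a => (uniformBits (D.coins κ)).map fun r => D.run κ a r) true).toReal

/-- The ensembles `X` and `Y` are `ρ`-indistinguishable in `I`: every probabilistic polynomial-time
distinguisher has advantage at most `ρ κ` for every sufficiently large `κ ∈ I`. -/
def IndistinguishableIn {α : Type} (ea : α → List (List Bool)) (ρ : ℕ → ℝ) (I : Set ℕ)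
    (X Y : ℕ → PMF α) : Prop :=
  ∀ D : PPTM ea bitWords, ∃ κ₀ : ℕ, ∀ κ ∈ I, κ₀ ≤ κ →
    |acceptProb D κ (X κ) - acceptProb D κ (Y κ)| ≤ ρ κ

/-! ### Forecasters -/

/-- A forecast `(p₁, p₂, p₃)` in `[0,1]³`, given by rational numbers: the probability that `X = 1`,
the probability that `Y = 1` if `X = 0`, and the probability that `Y = 1` if `X = 1`. -/
abbrev Forecast : Type := Set.Icc (0 : ℚ) 1 × Set.Icc (0 : ℚ) 1 × Set.Icc (0 : ℚ) 1

/-- A rational number in `[0,1]`, written as numerator and denominator (in lowest terms) in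
binary. -/
def ratWords (q : Set.Icc (0 : ℚ) 1) : List (List Bool) :=
  [Computability.encodeNat q.1.num.toNat, Computability.encodeNat q.1.den]

/-- A forecast, written as three numerators and denominators. -/
def forecastWords (p : Forecast) : List (List Bool) :=
  ratWords p.1 ++ ratWords p.2.1 ++ ratWords p.2.2

/-- A two-sided forecaster: a probabilistic polynomial-time machine which on input `(1^κ, t)`, for a
binary string `t`, outputs a triplet in `[0,1]³`. -/
abbrev Forecaster : Type := PPTM (fun t : List Bool => [t]) forecastWords

/-- `U_p` for `p ∈ [0,1]`: the distribution of a bit that is one with probability `p`. -/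
def biasedBit (p : Set.Icc (0 : ℚ) 1) : PMF Bool :=
  PMF.ofFintype
    (fun b => if b then ENNReal.ofReal ((p.1 : ℚ) : ℝ) else 1 - ENNReal.ofReal ((p.1 : ℚ) : ℝ)) (by
      have h : ENNReal.ofReal ((p.1 : ℚ) : ℝ) ≤ 1 :=
        ENNReal.ofReal_le_one.2 (by exact_mod_cast p.2.2)
      simp [h])

/-- `U_p` for `p = (p₁, p₂, p₃) ∈ [0,1]³`: the first bit `x` is one with probability `p₁`, and then
the second bit is one with probability `p₂` if `x = 0` and `p₃` if `x = 1`. -/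
def biasedPair (p : Forecast) : PMF (Bool × Bool) :=
  (biasedBit p.1).bind fun x =>
    (biasedBit (if x then p.2.2 else p.2.1)).map fun y => (x, y)

/-- A distribution of two bits `X`, `Y` and a string `T`. -/
abbrev TripleDist : Type := PMF (Bool × Bool × List Bool)

/-- A tuple `(x, y, t, r)`, written as four words. -/
def tupleWords (a : Bool × Bool × List Bool × List Bool) : List (List Bool) :=
  [[a.1], [a.2.1], a.2.2.1, a.2.2.2]

/-- The real distribution `(X_κ, Y_κ, T_κ, R_κ)`, where `R_κ` is a uniform independent string of
coins of the forecaster. -/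
def realDist (Z : ℕ → TripleDist) (F : Forecaster) (κ : ℕ) :
    PMF (Bool × Bool × List Bool × List Bool) :=
  (Z κ).bind fun z => (uniformBits (F.coins κ)).map fun r =>
    (z.1, z.2.1, z.2.2, List.ofFn r)

/-- The forecasted distribution `(U_p, T_κ, R_κ)` for `p = F(1^κ, T_κ; R_κ)`. -/
def forecastDist (Z : ℕ → TripleDist) (F : Forecaster) (κ : ℕ) :
    PMF (Bool × Bool × List Bool × List Bool) :=
  (Z κ).bind fun z => (uniformBits (F.coins κ)).bind fun r =>
    (biasedPair (F.run κ z.2.2 r)).map fun xy => (xy.1, xy.2, z.2.2, List.ofFn r)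

/-- The forecaster `F` is `(ρ, I)`-indistinguishable with respect to the ensemble `Z`. -/
def Forecaster.Indistinguishable (F : Forecaster) (ρ : ℝ) (I : Set ℕ) (Z : ℕ → TripleDist) :
    Prop :=
  IndistinguishableIn tupleWords (fun _ => ρ) I (realDist Z F) (forecastDist Z F)

/-! ### Two-party protocols -/

/-- A no-input, single-bit output two-party protocol, whose parties may be computationally unbounded.
On security parameter `κ`, the parties `A` and `B` toss `coinsA κ` and `coinsB κ` private coins
and exchange `rounds κ` messages (possibly empty strings), alternately and starting with `A`.
Every message, and in the end the output bit of each party, is an arbitrary function of `κ`, of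
the private coins of the party and of the messages sent so far. -/
structure Protocol where
  rounds : ℕ → ℕ
  coinsA : ℕ → ℕ
  coinsB : ℕ → ℕ
  nextA : (κ : ℕ) → (Fin (coinsA κ) → Bool) → List (List Bool) → List Bool
  nextB : (κ : ℕ) → (Fin (coinsB κ) → Bool) → List (List Bool) → List Bool
  outA : (κ : ℕ) → (Fin (coinsA κ) → Bool) → List (List Bool) → Bool
  outB : (κ : ℕ) → (Fin (coinsB κ) → Bool) → List (List Bool) → Bool

namespace Protocol

/-- The list of the first `i` messages when the private coins are `rA` and `rB`. -/
def messages (π : Protocol) (κ : ℕ) (rA : Fin (π.coinsA κ) → Bool)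
    (rB : Fin (π.coinsB κ) → Bool) : ℕ → List (List Bool)
  | 0 => []
  | i + 1 =>
    let h := messages π κ rA rB i
    h ++ [if Even i then π.nextA κ rA h else π.nextB κ rB h]

/-- The joint distribution of the output bits of `A` and `B` and of the transcript (the concatenation
of all messages) in a random execution with security parameter `κ`. -/
def outputDist (π : Protocol) (κ : ℕ) : TripleDist :=
  (uniformBits (π.coinsA κ)).bind fun rA => (uniformBits (π.coinsB κ)).map fun rB =>
    let h := π.messages κ rA rB (π.rounds κ)
    (π.outA κ rA h, π.outB κ rB h, h.flatten)

end Protocol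

end

/-! The proof is an energy increment argument. A feature map is a polynomial-time map of `(κ, t, r)`
into a fixed finite set `S`. It induces a joint law of the feature and the two output bits, and its
energy is the mean squared norm of the conditional law of the bits given the feature, a number in
`[0, 1]`.

The natural forecaster for a feature map outputs the conditional law of the bits given the feature,
rounded to a finite grid (`exists_gridForecast`). The right table `S → grid` depends on `κ` and need
not be computable. There are only finitely many tables, however, so one of them is right for
infinitely many `κ` (`exists_infinite_fiber_of_infinite`). Hardwired, it gives a polynomial-time
machine, `FeatureMap.forecaster`; this is the reason for passing to an infinite subset.

If this forecaster fails, some distinguisher `D` has advantage above `ρ` at infinitely many of these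
`κ`. Adjoin to the feature the four decisions of `D` on the possible pairs of bits, for fresh coins
of `D` (`FeatureMap.refine`). Both acceptance probabilities of `D` are then determined by the joint
law of the refined feature and the bits. A large advantage means that the conditional law given the
refined feature is far on average from the one given the old feature. By Cauchy–Schwarz and the
variance identity `sum_sub_sq_div`, the energy grows by a constant (`energy_increment`,
`FeatureMap.energy_refine`). Since energy is at most one, this happens only boundedly often.

What remains is that refined features and table lookups run in polynomial time. Programs that call
machines as subroutines (`StackProgram`) are compiled to multi-stack machines. They yield
composition and concatenation of outputs, finite-state transducers and the splitting of a coin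
string, from which `refineFeat_polyTime` and `forecaster` are assembled. -/

open Turing

/-! ### Step-counted reachability -/

/-- `f` leads from `a` to `b` in at most `n` steps. -/
def ReachesIn {σ : Type} (f : σ → Option σ) (n : ℕ) (a b : σ) : Prop :=
  ∃ k ≤ n, (flip bind f)^[k] (some a) = some b

namespace ReachesIn

variable {σ : Type} {f : σ → Option σ} {n m : ℕ} {a b c : σ}

theorem refl (a : σ) : ReachesIn f 0 a a := ⟨0, le_rfl, rfl⟩

theorem single (h : f a = some b) : ReachesIn f 1 a b := ⟨1, le_rfl, h⟩

theorem trans (h₁ : ReachesIn f n a b) (h₂ : ReachesIn f m b c) : ReachesIn f (n + m) a c := by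
  obtain ⟨k, hk, hab⟩ := h₁
  obtain ⟨l, hl, hbc⟩ := h₂
  refine ⟨l + k, by lia, ?_⟩
  rw [Function.iterate_add_apply, hab, hbc]

theorem mono (h : ReachesIn f n a b) (hnm : n ≤ m) : ReachesIn f m a b :=
  let ⟨k, hk, e⟩ := h
  ⟨k, hk.trans hnm, e⟩

theorem head (h : f a = some b) (h₂ : ReachesIn f n b c) : ReachesIn f (n + 1) a c :=
  ((single h).trans h₂).mono (by lia)

theorem iterate_none (k : ℕ) : (flip bind f)^[k] none = none := by
  induction k with
  | zero => rfl
  | succ k ih => rw [Function.iterate_succ_apply]; exact ih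

/-- A simulation maps runs to runs. -/
theorem map {τ : Type} {g : τ → Option τ} (e : σ → τ)
    (he : ∀ a b, f a = some b → g (e a) = some (e b)) (h : ReachesIn f n a b) :
    ReachesIn g n (e a) (e b) := by
  obtain ⟨k, hk, h⟩ := h
  refine ReachesIn.mono ?_ hk
  clear hk
  induction k generalizing a with
  | zero =>
    obtain rfl : a = b := by simpa using h
    exact refl _
  | succ k ih =>
    rw [Function.iterate_succ_apply] at h
    cases hfa : f a with
    | none =>
      have : flip bind f (some a) = none := hfa
      rw [this, iterate_none] at h
      cases h
    | some a' =>
      have : flip bind f (some a) = some a' := hfa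
      rw [this] at h
      exact head (he _ _ hfa) (ih h)

/-- A quantity that grows by at most `C` in each step grows by at most `C * n` in `n` steps. -/
theorem measure_le (μ : σ → ℕ) (C : ℕ) (hμ : ∀ a b, f a = some b → μ b ≤ μ a + C)
    (h : ReachesIn f n a b) : μ b ≤ μ a + C * n := by
  obtain ⟨k, hk, h⟩ := h
  refine le_trans ?_ (Nat.add_le_add_left (Nat.mul_le_mul_left C hk) _)
  clear hk
  induction k generalizing a with
  | zero =>
    obtain rfl : a = b := by simpa using h
    simp
  | succ k ih =>
    rw [Function.iterate_succ_apply] at h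
    cases hfa : f a with
    | none =>
      have : flip bind f (some a) = none := hfa
      rw [this, iterate_none] at h
      cases h
    | some a' =>
      have : flip bind f (some a) = some a' := hfa
      rw [this] at h
      have h₁ := ih h
      have h₂ := hμ _ _ hfa
      rw [Nat.mul_succ]
      lia

end ReachesIn

/-! ### Machines on binary tapes -/

/-- The alphabet `{0, 1, blank}`. -/
abbrev TapeSym : Type := Option Bool

/-- A machine whose input and output are words over `{0, 1, blank}`. -/
abbrev TapeMachine : Type 1 := TM2ComputableAux TapeSym TapeSym

namespace TapeMachine

/-- The stacks of a machine when the input stack holds `x` and the others are empty. -/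
def inputStk (M : TapeMachine) (x : List TapeSym) : ∀ k, List (M.tm.Γ k) :=
  Function.update (fun _ => []) M.tm.k₀ (x.map M.inputAlphabet.symm)

/-- The stacks of a machine when the output stack holds `x` and the others are empty. -/
def outputStk (M : TapeMachine) (x : List TapeSym) : ∀ k, List (M.tm.Γ k) :=
  Function.update (fun _ => []) M.tm.k₁ (x.map M.outputAlphabet.symm)

/-- On input `x` the machine halts in at most `n` steps with output `y`. -/
def Outputs (M : TapeMachine) (x y : List TapeSym) (n : ℕ) : Prop :=
  ReachesIn (TM2.step M.tm.m) n ⟨some M.tm.main, M.tm.initialState, M.inputStk x⟩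
    ⟨none, M.tm.initialState, M.outputStk y⟩

theorem initList_eq (M : TapeMachine) (x : List TapeSym) :
    initList M.tm (x.map M.inputAlphabet.invFun) =
      ⟨some M.tm.main, M.tm.initialState, M.inputStk x⟩ := by
  unfold initList inputStk
  congr 1
  funext k
  by_cases h : k = M.tm.k₀
  · subst h
    simp
  · simp [h]

theorem haltList_eq (M : TapeMachine) (x : List TapeSym) :
    haltList M.tm (x.map M.outputAlphabet.invFun) =
      ⟨none, M.tm.initialState, M.outputStk x⟩ := by
  unfold haltList outputStk
  congr 1
  funext k
  by_cases h : k = M.tm.k₁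
  · subst h
    simp
  · simp [h]

theorem outputs_iff (M : TapeMachine) (x y : List TapeSym) (n : ℕ) :
    M.Outputs x y n ↔ Nonempty (TM2OutputsInTime M.tm (x.map M.inputAlphabet.invFun)
      (some (y.map M.outputAlphabet.invFun)) n) := by
  unfold Outputs TM2OutputsInTime
  rw [initList_eq]
  simp only [Option.map_some, haltList_eq]
  constructor
  · rintro ⟨k, hk, h⟩
    exact ⟨⟨⟨k, h⟩, hk⟩⟩
  · rintro ⟨⟨⟨k, h⟩, hk⟩⟩
    exact ⟨k, hk, h⟩

/-- A statement pushes a bounded number of symbols. -/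
theorem exists_length_stepAux_le {K Λ σ : Type} [DecidableEq K] {Γ : K → Type}
    (q : TM2.Stmt Γ Λ σ) (k : K) :
    ∃ C : ℕ, ∀ v S, ((TM2.stepAux q v S).stk k).length ≤ (S k).length + C := by
  induction q with
  | push k' f q ih =>
    obtain ⟨C, hC⟩ := ih
    refine ⟨C + 1, fun v S => (hC _ _).trans ?_⟩
    by_cases h : k = k'
    · subst h; simp; lia
    · simp [h]
  | peek k' f q ih =>
    obtain ⟨C, hC⟩ := ih
    exact ⟨C, fun v S => hC _ _⟩
  | pop k' f q ih =>
    obtain ⟨C, hC⟩ := ih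
    refine ⟨C, fun v S => (hC _ _).trans ?_⟩
    by_cases h : k = k'
    · subst h; simp
    · simp [h]
  | load a q ih =>
    obtain ⟨C, hC⟩ := ih
    exact ⟨C, fun v S => hC _ _⟩
  | branch p q₁ q₂ ih₁ ih₂ =>
    obtain ⟨C₁, h₁⟩ := ih₁
    obtain ⟨C₂, h₂⟩ := ih₂
    refine ⟨C₁ + C₂, fun v S => ?_⟩
    have := h₁ v S
    have := h₂ v S
    rw [TM2.stepAux]
    cases p v
    · rw [cond_false]; lia
    · rw [cond_true]; lia
  | goto l => exact ⟨0, fun v S => by simp⟩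
  | halt => exact ⟨0, fun v S => by simp⟩

/-- The output of a machine is not much longer than its input and its running time. -/
theorem exists_length_output_le (M : TapeMachine) :
    ∃ C : ℕ, ∀ x y n, M.Outputs x y n → y.length ≤ x.length + C * n := by
  have := M.tm.ΛFin
  -- There are finitely many labels, so the sum of the bounds for the single statements bounds the
  -- growth in every step.
  choose C hC using fun l => exists_length_stepAux_le (M.tm.m l) M.tm.k₁
  refine ⟨∑ l, C l, fun x y n h => ?_⟩
  have := h.measure_le (fun c => (c.stk M.tm.k₁).length) (∑ l, C l) ?_
  · have hx : (M.inputStk x M.tm.k₁).length ≤ x.length := by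
      unfold inputStk
      by_cases h : M.tm.k₁ = M.tm.k₀
      · rw [h]; simp
      · simp [h]
    simp only [outputStk, Function.update_self, List.length_map] at this
    lia
  · rintro ⟨_ | l, v, S⟩ b hb
    · cases hb
    · simp only [TM2.step, Option.some.injEq] at hb
      subst hb
      exact (hC l v S).trans
        (Nat.add_le_add_left (Finset.single_le_sum (fun _ _ => Nat.zero_le _) (Finset.mem_univ l)) _)

end TapeMachine

/-- A machine that runs in polynomial time turns the tape `e a` into the tape `o a`, for all `a`. -/
def PolyTimeTapes {α : Type} (e o : α → List TapeSym) : Prop :=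
  ∃ (M : TapeMachine) (p : Polynomial ℕ), ∀ a, M.Outputs (e a) (o a) (p.eval (e a).length)

theorem polyTimeComputable_iff {α β : Type} (ea : α → List (List Bool)) (eb : β → List (List Bool))
    (f : α → β) :
    PolyTimeComputable ea eb f ↔
      PolyTimeTapes (fun a => tapeOf (ea a)) (fun a => tapeOf (eb (f a))) := by
  constructor
  · rintro ⟨h⟩
    exact ⟨h.toTM2ComputableAux, h.time, fun a => (TapeMachine.outputs_iff _ _ _ _).2
      ⟨h.outputsFun a⟩⟩
  · rintro ⟨M, p, h⟩
    exact ⟨⟨M, p, fun a => ((TapeMachine.outputs_iff _ _ _ _).1 (h a)).some⟩⟩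

/-! ### Programs that call machines -/

/-- An instruction of a program with stacks `A` over `{0, 1, blank}`, machines `J` and labels `L`. -/
inductive Instr (J A L : Type) : Type where
  /-- move the stack `a` symbol by symbol onto each of the stacks `bs` -/
  | move (a : A) (bs : List A) (next : L)
  /-- pop a symbol and continue at a label that depends on it -/
  | read (a : A) (next : Option TapeSym → L)
  /-- push symbols -/
  | write (a : A) (ws : List TapeSym) (next : L)
  /-- run a machine -/
  | apply (j : J)
  | halt

/-- A program that uses the machines `M j` as subroutines. The machine `j` takes the reverse of the
stack `src j` as its input and pushes its output symbol by symbol on the stack `dst j`. -/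
structure StackProgram {J : Type} (M : J → TapeMachine) where
  A : Type
  L : Type
  [finA : Fintype A]
  [decA : DecidableEq A]
  [finL : Fintype L]
  inp : A
  out : A
  start : L
  src : J → A
  dst : J → A
  ret : J → L
  code : L → Instr J A L

attribute [instance] StackProgram.finA StackProgram.decA StackProgram.finL

namespace StackProgram

variable {J : Type} {M : J → TapeMachine} (P : StackProgram M)

/-- The stacks: those of all machines, and those of the program. -/
abbrev Stack : Type := (Σ j, (M j).tm.K) ⊕ P.A

/-- The alphabet of a stack. -/
@[reducible] def Alphabet : P.Stack → Type
  | .inl p => (M p.1).tm.Γ p.2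
  | .inr _ => TapeSym

/-- The labels: those of all machines, two loops that load and unload a machine, and those of the
program. -/
abbrev Label : Type := (Σ j, (M j).tm.Λ) ⊕ (J ⊕ J) ⊕ P.L

/-- The states: one for each machine, and a symbol read. -/
abbrev State (_P : StackProgram M) : Type := (∀ j, (M j).tm.σ) × Option TapeSym

/-- Statements of the machine that runs the program. -/
abbrev Code : Type := TM2.Stmt P.Alphabet P.Label P.State

/-- The label of the loop that loads the machine `j`. -/
abbrev loadLabel (j : J) : P.Label := Sum.inr (Sum.inl (Sum.inl j))

/-- The label of the loop that unloads the machine `j`. -/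
abbrev unloadLabel (j : J) : P.Label := Sum.inr (Sum.inl (Sum.inr j))

/-- The label of an instruction of the program. -/
abbrev label (l : P.L) : P.Label := Sum.inr (Sum.inr l)

/-- Push `x` on each of several stacks. -/
def pushOn (P : StackProgram M) (x : List TapeSym) :
    List P.A → (P.A → List TapeSym) → P.A → List TapeSym
  | [], T => T
  | b :: bs, T => P.pushOn x bs (Function.update T b (x ++ T b))

section

variable {P} {T : P.A → List TapeSym}

theorem pushOn_apply_of_notMem {x : List TapeSym} {bs : List P.A} {a : P.A} (h : a ∉ bs) :
    P.pushOn x bs T a = T a := by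
  induction bs generalizing T with
  | nil => rfl
  | cons b bs ih =>
    rw [List.mem_cons, not_or] at h
    rw [pushOn, ih h.2, Function.update_of_ne h.1]

theorem pushOn_update {x y : List TapeSym} {bs : List P.A} {a : P.A} (h : a ∉ bs) :
    P.pushOn x bs (Function.update T a y) = Function.update (P.pushOn x bs T) a y := by
  induction bs generalizing T with
  | nil => rfl
  | cons b bs ih =>
    rw [List.mem_cons, not_or] at h
    rw [pushOn, pushOn, Function.update_comm h.1, ih h.2, Function.update_of_ne (Ne.symm h.1)]

theorem pushOn_pushOn {x y : List TapeSym} {bs : List P.A} (h : bs.Nodup) :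
    P.pushOn y bs (P.pushOn x bs T) = P.pushOn (y ++ x) bs T := by
  induction bs generalizing T with
  | nil => rfl
  | cons b bs ih =>
    rw [List.nodup_cons] at h
    simp only [pushOn]
    rw [pushOn_apply_of_notMem h.1, ← pushOn_update h.1, ih h.2]
    simp

theorem pushOn_nil {bs : List P.A} : P.pushOn [] bs T = T := by
  induction bs generalizing T with
  | nil => rfl
  | cons b bs ih => simp [pushOn, ih]

end

variable [DecidableEq J]

/-- A statement of the machine `j` as a statement of the whole machine. -/
def lift (j : J) : TM2.Stmt (M j).tm.Γ (M j).tm.Λ (M j).tm.σ → P.Code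
  | .push k f q => .push (Sum.inl ⟨j, k⟩ : P.Stack) (fun v => f (v.1 j)) (lift j q)
  | .peek k f q =>
    .peek (Sum.inl ⟨j, k⟩ : P.Stack) (fun v o => (Function.update v.1 j (f (v.1 j) o), v.2))
      (lift j q)
  | .pop k f q =>
    .pop (Sum.inl ⟨j, k⟩ : P.Stack) (fun v o => (Function.update v.1 j (f (v.1 j) o), v.2))
      (lift j q)
  | .load f q => .load (fun v => (Function.update v.1 j (f (v.1 j)), v.2)) (lift j q)
  | .branch p q₁ q₂ => .branch (fun v => p (v.1 j)) (lift j q₁) (lift j q₂)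
  | .goto l => .goto fun v => Sum.inl ⟨j, l (v.1 j)⟩
  | .halt => .goto fun _ => P.unloadLabel j

/-- Forget the symbol read and jump. -/
def resume (l : P.Label) : P.Code := .load (fun v => (v.1, none)) (.goto fun _ => l)

/-- Push the symbol read on several stacks. -/
def pushAll : List P.A → P.Code → P.Code
  | [], q => q
  | b :: bs, q => .push (Sum.inr b : P.Stack) (fun v => v.2.getD none) (pushAll bs q)

/-- Push several constants. -/
def pushConst (a : P.A) : List TapeSym → P.Code → P.Code
  | [], q => q
  | w :: ws, q => .push (Sum.inr a : P.Stack) (fun _ => w) (pushConst a ws q)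

/-- The statement that executes an instruction. -/
def exec (l : P.L) : Instr J P.A P.L → P.Code
  | .move a bs next =>
    .pop (Sum.inr a : P.Stack) (fun v o => (v.1, o))
      (.branch (fun v => v.2.isNone) (P.resume (P.label next))
        (P.pushAll bs (P.resume (P.label l))))
  | .read a next =>
    .pop (Sum.inr a : P.Stack) (fun v o => (v.1, o))
      (.branch (fun v => v.2 = none) (P.resume (P.label (next none)))
        (.branch (fun v => v.2 = some none) (P.resume (P.label (next (some none))))
          (.branch (fun v => v.2 = some (some true)) (P.resume (P.label (next (some (some true)))))
            (P.resume (P.label (next (some (some false))))))))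
  | .write a ws next => P.pushConst a ws (P.resume (P.label next))
  | .apply j => .goto fun _ => P.loadLabel j
  | .halt => .halt

/-- The statement at a label. -/
def body : P.Label → P.Code
  | .inl ⟨j, l⟩ => P.lift j ((M j).tm.m l)
  | .inr (.inl (.inl j)) =>
    .pop (Sum.inr (P.src j) : P.Stack) (fun v o => (v.1, o))
      (.branch (fun v => v.2.isNone) (P.resume (Sum.inl ⟨j, (M j).tm.main⟩))
        (.push (Sum.inl ⟨j, (M j).tm.k₀⟩ : P.Stack)
          (fun v => (M j).inputAlphabet.symm (v.2.getD none)) (P.resume (P.loadLabel j))))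
  | .inr (.inl (.inr j)) =>
    .pop (Sum.inl ⟨j, (M j).tm.k₁⟩ : P.Stack) (fun v o => (v.1, o.map (M j).outputAlphabet))
      (.branch (fun v => v.2.isNone) (P.resume (P.label (P.ret j)))
        (.push (Sum.inr (P.dst j) : P.Stack) (fun v => v.2.getD none)
          (P.resume (P.unloadLabel j))))
  | .inr (.inr l) => P.exec l (P.code l)

/-- The initial states of all machines. -/
abbrev initStates (_P : StackProgram M) : ∀ j, (M j).tm.σ := fun j => (M j).tm.initialState

/-- All stacks together. -/
def allStacks (S : ∀ j k, List ((M j).tm.Γ k)) (T : P.A → List TapeSym) :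
    ∀ k : P.Stack, List (P.Alphabet k)
  | .inl p => S p.1 p.2
  | .inr a => T a

/-- The configuration in which the program is at the label `l` with stacks `T`. -/
def cfg (l : P.L) (T : P.A → List TapeSym) : TM2.Cfg P.Alphabet P.Label P.State :=
  ⟨some (P.label l), (P.initStates, none), P.allStacks (fun _ _ => []) T⟩

/-! ### Semantics of compiled programs -/

theorem update_stacks_inl (S : ∀ j k, List ((M j).tm.Γ k)) (T : P.A → List TapeSym) (j : J)
    (k : (M j).tm.K) (x : List ((M j).tm.Γ k)) :
    Function.update (P.allStacks S T) (Sum.inl ⟨j, k⟩) x =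
      P.allStacks (Function.update S j (Function.update (S j) k x)) T := by
  funext k'
  rcases k' with ⟨j', k'⟩ | a
  · by_cases hj : j' = j
    · subst hj
      by_cases hk : k' = k
      · subst hk
        simp [allStacks]
      · have : (Sum.inl ⟨j', k'⟩ : P.Stack) ≠ Sum.inl ⟨j', k⟩ := by
          simpa using hk
        rw [Function.update_of_ne this]
        simp [allStacks, hk]
    · have : (Sum.inl ⟨j', k'⟩ : P.Stack) ≠ Sum.inl ⟨j, k⟩ := by
        intro h
        simp only [Sum.inl.injEq, Sigma.mk.injEq] at h
        exact hj h.1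
      rw [Function.update_of_ne this]
      simp [allStacks, hj]
  · rw [Function.update_of_ne (by simp)]
    simp [allStacks]

theorem update_stacks_inr (S : ∀ j k, List ((M j).tm.Γ k)) (T : P.A → List TapeSym) (a : P.A)
    (x : List TapeSym) :
    Function.update (P.allStacks S T) (Sum.inr a) x = P.allStacks S (Function.update T a x) := by
  funext k'
  rcases k' with ⟨j', k'⟩ | b
  · rw [Function.update_of_ne (by simp)]
    simp [allStacks]
  · by_cases hb : b = a
    · subst hb
      simp [allStacks]
    · rw [Function.update_of_ne (by simpa using hb)]
      simp [allStacks, hb]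

/-- A configuration of the machine `j` as a configuration of the whole machine. -/
def liftCfg (j : J) (T : P.A → List TapeSym) (c : TM2.Cfg (M j).tm.Γ (M j).tm.Λ (M j).tm.σ) :
    TM2.Cfg P.Alphabet P.Label P.State :=
  ⟨some (c.l.elim (P.unloadLabel j) fun l => Sum.inl ⟨j, l⟩),
    (Function.update P.initStates j c.var, none),
    P.allStacks (Function.update (fun _ _ => []) j c.stk) T⟩

theorem stepAux_lift (j : J) (T : P.A → List TapeSym)
    (q : TM2.Stmt (M j).tm.Γ (M j).tm.Λ (M j).tm.σ) (v : (M j).tm.σ)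
    (S : ∀ k, List ((M j).tm.Γ k)) :
    TM2.stepAux (P.lift j q) (Function.update P.initStates j v, none)
        (P.allStacks (Function.update (fun _ _ => []) j S) T) =
      P.liftCfg j T (TM2.stepAux q v S) := by
  induction q generalizing v S with
  | push k f q ih =>
    simp only [lift, TM2.stepAux, update_stacks_inl, Function.update_idem]
    rw [← ih]
    simp [allStacks]
  | peek k f q ih =>
    simp only [lift, TM2.stepAux, Function.update_idem]
    rw [← ih]
    simp [allStacks]
  | pop k f q ih =>
    simp only [lift, TM2.stepAux, update_stacks_inl, Function.update_idem]
    rw [← ih]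
    simp [allStacks]
  | load f q ih =>
    simp only [lift, TM2.stepAux, Function.update_idem]
    rw [← ih]
    simp
  | branch p q₁ q₂ ih₁ ih₂ =>
    simp only [lift, TM2.stepAux, Function.update_self]
    cases p v
    · simpa using ih₂ v S
    · simpa using ih₁ v S
  | goto l => simp [lift, liftCfg]
  | halt => simp [lift, liftCfg]

/-- The simulation is step by step, so `ReachesIn.map` transfers running times unchanged. A halted
configuration of the machine `j` lifts to the start of its unloading loop, which is where control
has to go next. -/
theorem step_liftCfg (j : J) (T : P.A → List TapeSym)
    (c c' : TM2.Cfg (M j).tm.Γ (M j).tm.Λ (M j).tm.σ) (h : TM2.step (M j).tm.m c = some c') :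
    TM2.step P.body (P.liftCfg j T c) = some (P.liftCfg j T c') := by
  obtain ⟨_ | l, v, S⟩ := c
  · cases h
  · simp only [TM2.step, Option.some.injEq] at h
    subst h
    rw [← stepAux_lift]
    rfl

/-- The program leads from label `l` and stacks `T` to label `l'` and stacks `T'` in at most `n`
steps. -/
def Reaches (n : ℕ) (l : P.L) (T : P.A → List TapeSym) (l' : P.L) (T' : P.A → List TapeSym) :
    Prop :=
  ReachesIn (TM2.step P.body) n (P.cfg l T) (P.cfg l' T')

variable {P} {l l' l'' : P.L} {T T' T'' : P.A → List TapeSym} {n m : ℕ}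

theorem Reaches.trans (h₁ : P.Reaches n l T l' T') (h₂ : P.Reaches m l' T' l'' T'') :
    P.Reaches (n + m) l T l'' T'' :=
  ReachesIn.trans h₁ h₂

theorem Reaches.mono (h : P.Reaches n l T l' T') (hnm : n ≤ m) : P.Reaches m l T l' T' :=
  ReachesIn.mono h hnm

theorem stepAux_pushAll (bs : List P.A) (q : P.Code) (s : ∀ j, (M j).tm.σ) (x : TapeSym)
    (S : ∀ j k, List ((M j).tm.Γ k)) (T : P.A → List TapeSym) :
    TM2.stepAux (P.pushAll bs q) (s, some x) (P.allStacks S T) =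
      TM2.stepAux q (s, some x) (P.allStacks S (P.pushOn [x] bs T)) := by
  induction bs generalizing T with
  | nil => rfl
  | cons b bs ih =>
    simp only [pushAll, TM2.stepAux, update_stacks_inr]
    rw [ih]
    rfl

theorem stepAux_pushConst (a : P.A) (ws : List TapeSym) (q : P.Code) (v : P.State)
    (S : ∀ j k, List ((M j).tm.Γ k)) (T : P.A → List TapeSym) :
    TM2.stepAux (P.pushConst a ws q) v (P.allStacks S T) =
      TM2.stepAux q v (P.allStacks S (Function.update T a (ws.reverse ++ T a))) := by
  induction ws generalizing T with
  | nil => simp [pushConst]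
  | cons w ws ih =>
    simp only [pushConst, TM2.stepAux, update_stacks_inr]
    rw [ih]
    simp [allStacks]

theorem Reaches.write {a : P.A} {ws : List TapeSym} (h : P.code l = .write a ws l') :
    P.Reaches 1 l T l' (Function.update T a (ws.reverse ++ T a)) := by
  refine ReachesIn.single ?_
  simp only [cfg, TM2.step, body, h, exec, stepAux_pushConst]
  rfl

theorem Reaches.read {a : P.A} {f : Option TapeSym → P.L} (h : P.code l = .read a f) :
    P.Reaches 1 l T (f (T a).head?) (Function.update T a (T a).tail) := by
  refine ReachesIn.single ?_
  rcases hT : T a with _ | ⟨_ | _ | _, _⟩ <;>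
    simp [cfg, body, h, exec, update_stacks_inr, allStacks, resume, hT]

theorem Reaches.move_cons {a : P.A} {bs : List P.A} (h : P.code l = .move a bs l')
    {x : TapeSym} {xs : List TapeSym} (hx : T a = x :: xs) :
    P.Reaches 1 l T l (P.pushOn [x] bs (Function.update T a xs)) := by
  refine ReachesIn.single ?_
  simp only [cfg, TM2.step, body, h, exec, TM2.stepAux, update_stacks_inr, allStacks, hx]
  simp [stepAux_pushAll, resume]

theorem Reaches.move_nil {a : P.A} {bs : List P.A} (h : P.code l = .move a bs l')
    (hx : T a = []) : P.Reaches 1 l T l' T := by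
  refine ReachesIn.single ?_
  simp only [cfg, TM2.step, body, h, exec, TM2.stepAux, update_stacks_inr, allStacks, hx]
  have : Function.update T a [] = T := by rw [← hx, Function.update_eq_self]
  simp [resume, this]

/-- Popping one stack onto others reverses the word. The additional step is the pop that finds the
stack empty. -/
theorem Reaches.move {a : P.A} {bs : List P.A} (h : P.code l = .move a bs l')
    (ha : a ∉ bs) (hbs : bs.Nodup) {xs : List TapeSym} (hx : T a = xs) :
    P.Reaches (xs.length + 1) l T l' (Function.update (P.pushOn xs.reverse bs T) a []) := by
  induction xs generalizing T with
  | nil =>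
    rw [List.reverse_nil, pushOn_nil, ← hx, Function.update_eq_self]
    exact (Reaches.move_nil h hx).mono (by simp)
  | cons x xs ih =>
    have h₁ := Reaches.move_cons h hx
    rw [pushOn_update ha] at h₁
    have h₂ := h₁.trans (ih (Function.update_self _ _ _))
    rw [pushOn_update ha, pushOn_pushOn hbs, Function.update_idem] at h₂
    rw [List.reverse_cons]
    exact h₂.mono (by rw [List.length_cons]; lia)

/-- Loading reverses the source stack onto the input stack; the word `ys` loaded so far is kept
general for the induction. -/
theorem reachesIn_load (j : J) (T : P.A → List TapeSym) (xs ys : List TapeSym)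
    (hx : T (P.src j) = xs) :
    ReachesIn (TM2.step P.body) (xs.length + 1)
      ⟨some (P.loadLabel j), (P.initStates, none),
        P.allStacks (Function.update (fun _ _ => []) j ((M j).inputStk ys)) T⟩
      (P.liftCfg j (Function.update T (P.src j) [])
        ⟨some (M j).tm.main, (M j).tm.initialState, (M j).inputStk (xs.reverse ++ ys)⟩) := by
  induction xs generalizing T ys with
  | nil =>
    refine ReachesIn.single ?_
    simp only [TM2.step, body, TM2.stepAux, update_stacks_inr, allStacks, hx, liftCfg, resume]
    simp
  | cons x xs ih =>
    have h := ih (Function.update T (P.src j) xs) (x :: ys) (Function.update_self _ _ _)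
    rw [Function.update_idem] at h
    rw [List.reverse_cons, List.append_assoc]
    refine ReachesIn.head ?_ h
    simp only [TM2.step, body, TM2.stepAux, update_stacks_inr, allStacks, hx, resume]
    simp [update_stacks_inl, TapeMachine.inputStk]

/-- The output lands reversed on top of the old content `zs` of the target, so two machines that
share a target have their outputs concatenated. -/
theorem reachesIn_unload (j : J) (T : P.A → List TapeSym) (ys zs : List TapeSym)
    (hz : T (P.dst j) = zs) :
    ReachesIn (TM2.step P.body) (ys.length + 1)
      ⟨some (P.unloadLabel j), (P.initStates, none),
        P.allStacks (Function.update (fun _ _ => []) j ((M j).outputStk ys)) T⟩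
      (P.cfg (P.ret j) (Function.update T (P.dst j) (ys.reverse ++ zs))) := by
  induction ys generalizing T zs with
  | nil =>
    refine ReachesIn.single ?_
    simp only [TM2.step, body, TM2.stepAux, update_stacks_inl, allStacks, ← hz, cfg, resume]
    simp [TapeMachine.outputStk]
  | cons y ys ih =>
    have h := ih (Function.update T (P.dst j) (y :: zs)) (y :: zs) (Function.update_self _ _ _)
    rw [Function.update_idem] at h
    rw [List.reverse_cons, List.append_assoc]
    refine ReachesIn.head ?_ h
    simp only [TM2.step, body, TM2.stepAux, update_stacks_inl, allStacks, ← hz, resume]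
    simp [update_stacks_inr, TapeMachine.outputStk]

/-- A call consists of one jump, loading, the simulated run and unloading. Each of the two loops
costs one step more than the length of its word, hence the constant 3. -/
theorem Reaches.apply {j : J} (h : P.code l = .apply j) {xs ys zs : List TapeSym} {n : ℕ}
    (hM : (M j).Outputs xs ys n) (hx : T (P.src j) = xs.reverse) (hz : T (P.dst j) = zs)
    (hne : P.dst j ≠ P.src j) :
    P.Reaches (xs.length + n + ys.length + 3) l T (P.ret j)
      (Function.update (Function.update T (P.src j) []) (P.dst j) (ys.reverse ++ zs)) := by
  have h₁ := reachesIn_load j T xs.reverse [] hx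
  have h₂ := ReachesIn.map _ (step_liftCfg (P := P) j (Function.update T (P.src j) [])) hM
  have h₃ := reachesIn_unload j (Function.update T (P.src j) []) ys zs
    (by rw [Function.update_of_ne hne, hz])
  rw [List.reverse_reverse, List.append_nil] at h₁
  have h₄ : TM2.step P.body (P.cfg l T) = some ⟨some (P.loadLabel j), (P.initStates, none),
      P.allStacks (Function.update (fun _ _ => []) j ((M j).inputStk [])) T⟩ := by
    simp [cfg, TM2.step, body, h, exec, TapeMachine.inputStk]
  have h₅ := h₁.trans h₂
  simp only [liftCfg, Option.elim_none, Function.update_eq_self] at h₅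
  refine (ReachesIn.head h₄ (h₅.trans h₃)).mono ?_
  rw [List.length_reverse]
  lia

/-- The machine that runs a program. -/
def toMachine (P : StackProgram M) [Fintype J] : TapeMachine where
  tm :=
    haveI := fun j => (M j).tm.kFin
    haveI := fun j => (M j).tm.ΛFin
    haveI := fun j => (M j).tm.σFin
    { K := P.Stack
      k₀ := Sum.inr P.inp
      k₁ := Sum.inr P.out
      Γ := P.Alphabet
      Λ := P.Label
      main := P.label P.start
      σ := P.State
      initialState := (P.initStates, none)
      Γk₀Fin := inferInstanceAs (Fintype TapeSym)
      m := P.body }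
  inputAlphabet := Equiv.refl _
  outputAlphabet := Equiv.refl _

/-- `Outputs` demands that the machine end in its initial state with every stack but the output
stack empty. Compiled code clears the register after each use and leaves subroutines in their
initial states with empty stacks, so only the stacks of the program itself need attention. The extra
step executes `halt`. -/
theorem toMachine_outputs [Fintype J] {xs ys : List TapeSym} (hl : P.code l = .halt)
    (h : P.Reaches n P.start (Function.update (fun _ => []) P.inp xs) l
      (Function.update (fun _ => []) P.out ys)) :
    P.toMachine.Outputs xs ys (n + 1) := by
  have h₁ : TM2.step P.body (P.cfg l (Function.update (fun _ => []) P.out ys)) =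
      some ⟨none, (P.initStates, none), P.allStacks (fun _ _ => [])
        (Function.update (fun _ => []) P.out ys)⟩ := by
    simp [cfg, TM2.step, body, hl, exec]
  have h₂ := ReachesIn.trans h (ReachesIn.single h₁)
  have h₃ : P.allStacks (fun _ _ => []) (fun _ => []) = fun _ => [] := by
    funext k
    cases k <;> rfl
  rw [cfg, ← update_stacks_inr, ← update_stacks_inr, h₃] at h₂
  have hx : xs.map P.toMachine.inputAlphabet.symm = xs := List.map_id xs
  have hy : ys.map P.toMachine.outputAlphabet.symm = ys := List.map_id ys
  unfold TapeMachine.Outputs TapeMachine.inputStk TapeMachine.outputStk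
  rw [hx, hy]
  exact h₂

end StackProgram

/-! ### Closure properties of polynomial-time computation -/

theorem Polynomial.eval_nat_mono (p : Polynomial ℕ) {m n : ℕ} (h : m ≤ n) :
    p.eval m ≤ p.eval n := by
  rw [Polynomial.eval_eq_sum_range, Polynomial.eval_eq_sum_range]
  exact Finset.sum_le_sum fun i _ => Nat.mul_le_mul_left _ (Nat.pow_le_pow_left h i)

/-- Two machines, one after the other. -/
@[reducible] def compProgram (M : Bool → TapeMachine) : StackProgram M where
  A := Fin 4
  L := Fin 5
  inp := 0
  out := 0
  start := 0
  src := fun j => bif j then 1 else 2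
  dst := fun j => bif j then 2 else 3
  ret := fun j => bif j then 2 else 3
  code := ![.move 0 [1] 1, .apply true, .apply false, .move 3 [0] 4, .halt]

/-- Two machines on the same input. -/
@[reducible] def pairProgram (M : Bool → TapeMachine) : StackProgram M where
  A := Fin 4
  L := Fin 5
  inp := 0
  out := 0
  start := 0
  src := fun j => bif j then 1 else 2
  dst := fun _ => 3
  ret := fun j => bif j then 2 else 3
  code := ![.move 0 [1, 2] 1, .apply true, .apply false, .move 3 [0] 4, .halt]

/-- Reversals cancel: the first move produces the reversed input that a call expects, each call
leaves its output reversed for the next one, and the last move restores the order. -/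
theorem compProgram_outputs {M : Bool → TapeMachine} {x y z : List TapeSym} {n m : ℕ}
    (h₁ : (M true).Outputs x y n) (h₂ : (M false).Outputs y z m) :
    (compProgram M).toMachine.Outputs x z
      (2 * x.length + 2 * y.length + 2 * z.length + n + m + 9) := by
  have s₁ : (compProgram M).Reaches (x.length + 1) (0 : Fin 5)
      (Function.update (fun _ => []) (0 : Fin 4) x) (1 : Fin 5)
      ![[], x.reverse, [], []] := by
    convert StackProgram.Reaches.move (P := compProgram M) (l := (0 : Fin 5))
      (T := (Function.update (fun _ => []) (0 : Fin 4) x)) rfl (by simp) (by simp) rfl using 1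
    · simp
    · funext i; fin_cases i <;> dsimp [StackProgram.pushOn] <;> simp
  have s₂ : (compProgram M).Reaches (x.length + n + y.length + 3) (1 : Fin 5)
      ![[], x.reverse, [], []] (2 : Fin 5)
      ![[], [], y.reverse, []] := by
    convert StackProgram.Reaches.apply (P := compProgram M) (l := (1 : Fin 5))
      (T := ![[], x.reverse, [], []]) (j := true) rfl h₁ (zs := []) rfl rfl
      (by simp) using 1
    · rfl
    · funext i; fin_cases i <;> simp
  have s₃ : (compProgram M).Reaches (y.length + m + z.length + 3) (2 : Fin 5)
      ![[], [], y.reverse, []] (3 : Fin 5)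
      ![[], [], [], z.reverse] := by
    convert StackProgram.Reaches.apply (P := compProgram M) (l := (2 : Fin 5))
      (T := ![[], [], y.reverse, []]) (j := false) rfl h₂ (zs := []) rfl rfl
      (by simp) using 1
    · rfl
    · funext i; fin_cases i <;> simp
  have s₄ : (compProgram M).Reaches (z.length + 1) (3 : Fin 5)
      ![[], [], [], z.reverse] (4 : Fin 5)
      (Function.update (fun _ => []) (0 : Fin 4) z) := by
    convert StackProgram.Reaches.move (P := compProgram M) (l := (3 : Fin 5))
      (T := ![[], [], [], z.reverse]) rfl (by simp) (by simp) rfl using 1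
    · simp
    · funext i; fin_cases i <;> dsimp [StackProgram.pushOn] <;> simp
  exact (StackProgram.toMachine_outputs (P := compProgram M) (l := (4 : Fin 5)) rfl
    (((s₁.trans s₂).trans s₃).trans s₄)).mono (by lia)

/-- The first move copies the input to both source stacks, and both calls unload onto the same
stack, which concatenates the outputs. -/
theorem pairProgram_outputs {M : Bool → TapeMachine} {x y z : List TapeSym} {n m : ℕ}
    (h₁ : (M true).Outputs x y n) (h₂ : (M false).Outputs x z m) :
    (pairProgram M).toMachine.Outputs x (y ++ z)
      (3 * x.length + 2 * y.length + 2 * z.length + n + m + 9) := by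
  have s₁ : (pairProgram M).Reaches (x.length + 1) (0 : Fin 5)
      (Function.update (fun _ => []) (0 : Fin 4) x) (1 : Fin 5)
      ![[], x.reverse, x.reverse, []] := by
    convert StackProgram.Reaches.move (P := pairProgram M) (l := (0 : Fin 5))
      (T := (Function.update (fun _ => []) (0 : Fin 4) x)) rfl (by simp) (by simp) rfl using 1
    · simp
    · funext i; fin_cases i <;> dsimp [StackProgram.pushOn] <;> simp
  have s₂ : (pairProgram M).Reaches (x.length + n + y.length + 3) (1 : Fin 5)
      ![[], x.reverse, x.reverse, []] (2 : Fin 5)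
      ![[], [], x.reverse, y.reverse] := by
    convert StackProgram.Reaches.apply (P := pairProgram M) (l := (1 : Fin 5))
      (T := ![[], x.reverse, x.reverse, []]) (j := true) rfl h₁ (zs := []) rfl rfl
      (by simp) using 1
    · rfl
    · funext i; fin_cases i <;> simp
  have s₃ : (pairProgram M).Reaches (x.length + m + z.length + 3) (2 : Fin 5)
      ![[], [], x.reverse, y.reverse] (3 : Fin 5)
      ![[], [], [], (y ++ z).reverse] := by
    convert StackProgram.Reaches.apply (P := pairProgram M) (l := (2 : Fin 5))
      (T := ![[], [], x.reverse, y.reverse]) (j := false) rfl h₂ (zs := y.reverse)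
      rfl rfl (by simp) using 1
    · rfl
    · funext i; fin_cases i <;> simp
  have s₄ : (pairProgram M).Reaches ((y ++ z).length + 1) (3 : Fin 5)
      ![[], [], [], (y ++ z).reverse] (4 : Fin 5)
      (Function.update (fun _ => []) (0 : Fin 4) (y ++ z)) := by
    convert StackProgram.Reaches.move (P := pairProgram M) (l := (3 : Fin 5))
      (T := ![[], [], [], (y ++ z).reverse]) rfl (by simp) (by simp) rfl using 1
    · simp [add_comm]
    · funext i; fin_cases i <;> dsimp [StackProgram.pushOn] <;> simp
  exact (StackProgram.toMachine_outputs (P := pairProgram M) (l := (4 : Fin 5)) rfl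
    (((s₁.trans s₂).trans s₃).trans s₄)).mono (by rw [List.length_append]; lia)

namespace PolyTimeTapes

variable {α β : Type} {e o o' : α → List TapeSym}

theorem comap (h : PolyTimeTapes e o) (f : β → α) :
    PolyTimeTapes (fun b => e (f b)) (fun b => o (f b)) :=
  let ⟨M, p, hM⟩ := h
  ⟨M, p, fun b => hM (f b)⟩

/-- One polynomial bounds both the time and the length of the output. Composition needs the latter,
because the time of the second machine is measured in the length of the intermediate tape. -/
theorem exists_length_le (h : PolyTimeTapes e o) :
    ∃ (M : TapeMachine) (p : Polynomial ℕ), ∀ a, M.Outputs (e a) (o a) (p.eval (e a).length) ∧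
      (o a).length ≤ p.eval (e a).length := by
  obtain ⟨M, p, hM⟩ := h
  obtain ⟨C, hC⟩ := M.exists_length_output_le
  refine ⟨M, Polynomial.X + (Polynomial.C C + 1) * p, fun a =>
    ⟨(hM a).mono ?_, (hC _ _ _ (hM a)).trans ?_⟩⟩
  all_goals
    simp only [Polynomial.eval_add, Polynomial.eval_mul, Polynomial.eval_X, Polynomial.eval_C,
      Polynomial.eval_one]
    nlinarith

/-- Composition. -/
theorem comp (h₁ : PolyTimeTapes e o) (h₂ : PolyTimeTapes o o') : PolyTimeTapes e o' := by
  obtain ⟨M₁, p, h₁⟩ := h₁.exists_length_le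
  obtain ⟨M₂, q, h₂⟩ := h₂.exists_length_le
  refine ⟨(compProgram fun b => bif b then M₁ else M₂).toMachine,
    2 * Polynomial.X + 3 * p + 3 * q.comp p + 9, fun a => ?_⟩
  refine (compProgram_outputs (M := fun b => bif b then M₁ else M₂) (h₁ a).1 (h₂ a).1).mono ?_
  have h₃ := Polynomial.eval_nat_mono q (h₁ a).2
  have h₄ := (h₁ a).2
  have h₅ := (h₂ a).2
  simp only [Polynomial.eval_add, Polynomial.eval_mul, Polynomial.eval_X, Polynomial.eval_comp,
    Polynomial.eval_ofNat]
  lia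

/-- The outputs of two computations on the same input, one after the other. -/
theorem append (h₁ : PolyTimeTapes e o) (h₂ : PolyTimeTapes e o') :
    PolyTimeTapes e (fun a => o a ++ o' a) := by
  obtain ⟨M₁, p, h₁⟩ := h₁.exists_length_le
  obtain ⟨M₂, q, h₂⟩ := h₂.exists_length_le
  refine ⟨(pairProgram fun b => bif b then M₁ else M₂).toMachine,
    3 * Polynomial.X + 3 * p + 3 * q + 9, fun a => ?_⟩
  refine (pairProgram_outputs (M := fun b => bif b then M₁ else M₂) (h₁ a).1 (h₂ a).1).mono ?_
  have h₄ := (h₁ a).2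
  have h₅ := (h₂ a).2
  simp only [Polynomial.eval_add, Polynomial.eval_mul, Polynomial.eval_X, Polynomial.eval_ofNat]
  lia

end PolyTimeTapes

/-! ### Finite-state transducers -/

/-- A finite automaton that emits words. -/
structure Transducer where
  Q : Type
  [finQ : Fintype Q]
  init : Q
  next : Q → TapeSym → Q
  emit : Q → TapeSym → List TapeSym
  flush : Q → List TapeSym

attribute [instance] Transducer.finQ

namespace Transducer

variable (D : Transducer)

/-- The output from the state `q`. -/
def outputFrom : D.Q → List TapeSym → List TapeSym
  | q, [] => D.flush q
  | q, x :: xs => D.emit q x ++ outputFrom (D.next q x) xs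

/-- The output. -/
def output (xs : List TapeSym) : List TapeSym := D.outputFrom D.init xs

/-- The labels of the program of a transducer. -/
inductive Label : Type where
  | read (q : D.Q)
  | emit (q : D.Q) (x : TapeSym)
  | flush (q : D.Q)
  | reverse
  | done

/-- The labels form a finite sum. -/
def labelEquiv : D.Label ≃ (D.Q ⊕ (D.Q × TapeSym) ⊕ D.Q ⊕ Bool) where
  toFun
    | .read q => .inl q
    | .emit q x => .inr (.inl (q, x))
    | .flush q => .inr (.inr (.inl q))
    | .reverse => .inr (.inr (.inr true))
    | .done => .inr (.inr (.inr false))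
  invFun
    | .inl q => .read q
    | .inr (.inl (q, x)) => .emit q x
    | .inr (.inr (.inl q)) => .flush q
    | .inr (.inr (.inr true)) => .reverse
    | .inr (.inr (.inr false)) => .done
  left_inv := by rintro (_ | _ | _ | _ | _) <;> rfl
  right_inv := by rintro (_ | _ | _ | _ | _) <;> rfl

instance : Fintype D.Label := Fintype.ofEquiv _ D.labelEquiv.symm

/-- The program of a transducer. -/
@[reducible] def program : StackProgram (fun j : Empty => j.elim) where
  A := Fin 2
  L := D.Label
  inp := 0
  out := 0
  start := .read D.init
  src := fun _ => 0
  dst := fun _ => 0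
  ret := fun _ => .done
  code
    | .read q => .read 0 fun x => x.elim (.flush q) (.emit q)
    | .emit q x => .write 1 (D.emit q x) (.read (D.next q x))
    | .flush q => .write 1 (D.flush q) .reverse
    | .reverse => .move 1 [0] .done
    | .done => .halt

theorem reaches_reverse (q : D.Q) (xs ys : List TapeSym) :
    D.program.Reaches (2 * xs.length + 2) (.read q) ![xs, ys.reverse] .reverse
      ![[], (ys ++ D.outputFrom q xs).reverse] := by
  induction xs generalizing q ys with
  | nil =>
    have s₁ : D.program.Reaches 1 (.read q) ![[], ys.reverse] (.flush q) ![[], ys.reverse] := by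
      convert StackProgram.Reaches.read (P := D.program) (l := .read q) rfl using 1
      · rfl
      · funext i; fin_cases i <;> simp
    have s₂ : D.program.Reaches 1 (.flush q) ![[], ys.reverse] .reverse
        ![[], (ys ++ D.flush q).reverse] := by
      convert StackProgram.Reaches.write (P := D.program) (l := .flush q) rfl using 1
      funext i; fin_cases i <;> simp
    exact s₁.trans s₂
  | cons x xs ih =>
    have s₁ : D.program.Reaches 1 (.read q) ![x :: xs, ys.reverse] (.emit q x)
        ![xs, ys.reverse] := by
      convert StackProgram.Reaches.read (P := D.program) (l := .read q) rfl using 1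
      · rfl
      · funext i; fin_cases i <;> simp
    have s₂ : D.program.Reaches 1 (.emit q x) ![xs, ys.reverse] (.read (D.next q x))
        ![xs, (ys ++ D.emit q x).reverse] := by
      convert StackProgram.Reaches.write (P := D.program) (l := .emit q x) rfl using 1
      funext i; fin_cases i <;> simp
    have s₃ := ih (D.next q x) (ys ++ D.emit q x)
    rw [List.append_assoc] at s₃
    exact ((s₁.trans s₂).trans s₃).mono (by rw [List.length_cons]; lia)

theorem program_outputs (xs : List TapeSym) :
    D.program.toMachine.Outputs xs (D.output xs) (2 * xs.length + (D.output xs).length + 4) := by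
  have s₁ := D.reaches_reverse D.init xs []
  have e : (![xs, [].reverse] : Fin 2 → List TapeSym) = Function.update (fun _ => []) 0 xs := by
    funext i; fin_cases i <;> simp
  rw [e] at s₁
  have s₂ : D.program.Reaches ((D.output xs).length + 1) .reverse ![[], (D.output xs).reverse]
      .done (Function.update (fun _ => []) (0 : Fin 2) (D.output xs)) := by
    convert StackProgram.Reaches.move (P := D.program) (l := .reverse)
      (T := ![[], (D.output xs).reverse]) rfl (by simp) (by simp) rfl using 1
    · simp
    · funext i; fin_cases i <;> dsimp [StackProgram.pushOn] <;> simp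
  exact (StackProgram.toMachine_outputs (P := D.program) (l := .done) rfl (s₁.trans s₂)).mono (by lia)

/-- There are finitely many pairs of a state and a symbol, so each letter read emits a bounded
number of letters. -/
theorem exists_length_output_le :
    ∃ C : ℕ, ∀ xs, (D.output xs).length ≤ C * (xs.length + 1) := by
  refine ⟨∑ q, (D.flush q).length + ∑ q, ∑ x, (D.emit q x).length, fun xs => ?_⟩
  have hf q : (D.flush q).length ≤ ∑ q, (D.flush q).length :=
    Finset.single_le_sum (f := fun q => (D.flush q).length) (fun _ _ => Nat.zero_le _)
      (Finset.mem_univ q)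
  have he q x : (D.emit q x).length ≤ ∑ q, ∑ x, (D.emit q x).length :=
    (Finset.single_le_sum (f := fun x => (D.emit q x).length) (fun _ _ => Nat.zero_le _)
      (Finset.mem_univ x)).trans
    (Finset.single_le_sum (f := fun q => ∑ x, (D.emit q x).length) (fun _ _ => Nat.zero_le _)
      (Finset.mem_univ q))
  unfold output
  generalize D.init = q
  induction xs generalizing q with
  | nil =>
    have := hf q
    simp only [outputFrom, List.length_nil]
    lia
  | cons x xs ih =>
    have h₁ := ih (D.next q x)
    have h₂ := he q x
    simp only [outputFrom, List.length_append, List.length_cons]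
    rw [Nat.mul_succ]
    lia

end Transducer

/-- Transducers run in polynomial time. -/
theorem PolyTimeTapes.transducer {α : Type} (D : Transducer) (e : α → List TapeSym) :
    PolyTimeTapes e (fun a => D.output (e a)) := by
  obtain ⟨C, hC⟩ := D.exists_length_output_le
  refine ⟨D.program.toMachine, (2 + Polynomial.C C) * (Polynomial.X + 1) + 4, fun a =>
    (D.program_outputs (e a)).mono ?_⟩
  have := hC (e a)
  simp only [Polynomial.eval_add, Polynomial.eval_mul, Polynomial.eval_X, Polynomial.eval_C,
    Polynomial.eval_one, Polynomial.eval_ofNat]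
  nlinarith

/-! ### Splitting a word -/

/-- Cut the second word after as many letters as the first word has. -/
@[reducible] def splitProgram : StackProgram (fun j : Empty => j.elim) where
  A := Fin 3
  L := Fin 8 ⊕ TapeSym
  inp := 0
  out := 0
  start := .inl 0
  src := fun _ => 0
  dst := fun _ => 0
  ret := fun _ => .inl 0
  code := Sum.elim
    ![.read 0 fun x => if (x.bind id).isSome then .inl 1 else .inl 2,
      .write 1 [some true] (.inl 0),
      .read 1 fun x => if x.isSome then .inl 3 else .inl 4,
      .read 0 fun x => x.elim (.inl 4) .inr,
      .write 2 [none] (.inl 5),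
      .move 0 [2] (.inl 6),
      .move 2 [0] (.inl 7),
      .halt]
    fun x => .write 2 [x] (.inl 2)

/-- The unary word becomes a counter on the second stack; the blank after it ends the loop. -/
theorem splitProgram_count (m k : ℕ) (ys : List TapeSym) :
    splitProgram.Reaches (2 * m + 1) (Sum.inl 0)
      ![List.replicate m (some true) ++ none :: ys, List.replicate k (some true), []]
      (Sum.inl 2) ![ys, List.replicate (m + k) (some true), []] := by
  induction m generalizing k with
  | zero =>
    convert StackProgram.Reaches.read (P := splitProgram) (l := Sum.inl 0)
      (T := ![List.replicate 0 (some true) ++ none :: ys, List.replicate k (some true), []])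
      rfl using 1
    · rfl
    · funext i; fin_cases i <;> simp
  | succ m ih =>
    have s₁ : splitProgram.Reaches 1 (Sum.inl 0)
        ![List.replicate (m + 1) (some true) ++ none :: ys, List.replicate k (some true), []]
        (Sum.inl 1) ![List.replicate m (some true) ++ none :: ys, List.replicate k (some true), []] := by
      convert StackProgram.Reaches.read (P := splitProgram) (l := Sum.inl 0)
        (T := ![List.replicate (m + 1) (some true) ++ none :: ys, List.replicate k (some true), []])
        rfl using 1
      · rfl
      · funext i; fin_cases i <;> simp [List.replicate_succ]
    have s₂ : splitProgram.Reaches 1 (Sum.inl 1)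
        ![List.replicate m (some true) ++ none :: ys, List.replicate k (some true), []]
        (Sum.inl 0)
        ![List.replicate m (some true) ++ none :: ys, List.replicate (k + 1) (some true), []] := by
      convert StackProgram.Reaches.write (P := splitProgram) (l := Sum.inl 1)
        (T := ![List.replicate m (some true) ++ none :: ys, List.replicate k (some true), []])
        rfl using 1
      funext i; fin_cases i <;> simp [List.replicate_succ]
    have s₃ := ih (k + 1)
    rw [show m + (k + 1) = m + 1 + k by lia] at s₃
    exact ((s₁.trans s₂).trans s₃).mono (by lia)

/-- Each unit of the counter pays for one transferred letter. The letter is remembered in the label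
`Sum.inr x` between its pop and its push, which makes three steps per letter. -/
theorem splitProgram_cut (xs ys zs : List TapeSym) :
    splitProgram.Reaches (3 * xs.length + 1) (Sum.inl 2)
      ![xs ++ ys, List.replicate xs.length (some true), zs] (Sum.inl 4)
      ![ys, [], xs.reverse ++ zs] := by
  induction xs generalizing zs with
  | nil =>
    convert StackProgram.Reaches.read (P := splitProgram) (l := Sum.inl 2)
      (T := ![[] ++ ys, List.replicate 0 (some true), zs]) rfl using 1
    · rfl
    · rfl
    · rfl
    · funext i; fin_cases i <;> simp
  | cons x xs ih =>
    have s₁ : splitProgram.Reaches 1 (Sum.inl 2)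
        ![x :: xs ++ ys, List.replicate (xs.length + 1) (some true), zs] (Sum.inl 3)
        ![x :: xs ++ ys, List.replicate xs.length (some true), zs] := by
      convert StackProgram.Reaches.read (P := splitProgram) (l := Sum.inl 2)
        (T := ![x :: xs ++ ys, List.replicate (xs.length + 1) (some true), zs]) rfl using 1
      · rfl
      · funext i; fin_cases i <;> simp [List.replicate_succ]
    have s₂ : splitProgram.Reaches 1 (Sum.inl 3)
        ![x :: xs ++ ys, List.replicate xs.length (some true), zs] (Sum.inr x)
        ![xs ++ ys, List.replicate xs.length (some true), zs] := by
      convert StackProgram.Reaches.read (P := splitProgram) (l := Sum.inl 3)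
        (T := ![x :: xs ++ ys, List.replicate xs.length (some true), zs]) rfl using 1
      · rfl
      · funext i; fin_cases i <;> simp
    have s₃ : splitProgram.Reaches 1 (Sum.inr x)
        ![xs ++ ys, List.replicate xs.length (some true), zs] (Sum.inl 2)
        ![xs ++ ys, List.replicate xs.length (some true), x :: zs] := by
      convert StackProgram.Reaches.write (P := splitProgram) (l := Sum.inr x)
        (T := ![xs ++ ys, List.replicate xs.length (some true), zs]) rfl using 1
      funext i; fin_cases i <;> simp
    have s₄ := ih (x :: zs)
    rw [List.reverse_cons, List.append_assoc]
    exact (((s₁.trans s₂).trans s₃).trans s₄).mono (by rw [List.length_cons]; lia)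

theorem splitProgram_outputs (xs ys : List TapeSym) :
    splitProgram.toMachine.Outputs (List.replicate xs.length (some true) ++ none :: (xs ++ ys))
      (xs ++ none :: ys) (6 * xs.length + 2 * ys.length + 7) := by
  have e : (![List.replicate xs.length (some true) ++ none :: (xs ++ ys), [], []] :
      Fin 3 → List TapeSym) = Function.update (fun _ => []) 0
        (List.replicate xs.length (some true) ++ none :: (xs ++ ys)) := by
    funext i; fin_cases i <;> simp
  have s₁ := splitProgram_count xs.length 0 (xs ++ ys)
  rw [List.replicate_zero, e, add_zero] at s₁
  have s₂ := splitProgram_cut xs ys []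
  rw [List.append_nil] at s₂
  have s₃ : splitProgram.Reaches 1 (Sum.inl 4) ![ys, [], xs.reverse] (Sum.inl 5)
      ![ys, [], none :: xs.reverse] := by
    convert StackProgram.Reaches.write (P := splitProgram) (l := Sum.inl 4)
      (T := ![ys, [], xs.reverse]) rfl using 1
    funext i; fin_cases i <;> simp
  have s₄ : splitProgram.Reaches (ys.length + 1) (Sum.inl 5) ![ys, [], none :: xs.reverse]
      (Sum.inl 6) ![[], [], (xs ++ none :: ys).reverse] := by
    convert StackProgram.Reaches.move (P := splitProgram) (l := Sum.inl 5)
      (T := ![ys, [], none :: xs.reverse]) rfl (by simp) (by simp) rfl using 1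
    · rfl
    · funext i; fin_cases i <;> dsimp [StackProgram.pushOn] <;> simp
  have s₅ : splitProgram.Reaches (xs.length + ys.length + 2) (Sum.inl 6)
      ![[], [], (xs ++ none :: ys).reverse] (Sum.inl 7)
      (Function.update (fun _ => []) (0 : Fin 3) (xs ++ none :: ys)) := by
    convert StackProgram.Reaches.move (P := splitProgram) (l := Sum.inl 6)
      (T := ![[], [], (xs ++ none :: ys).reverse]) rfl (by simp) (by simp) rfl using 1
    · simp
      lia
    · funext i; fin_cases i <;> dsimp [StackProgram.pushOn] <;> simp
  exact (StackProgram.toMachine_outputs (P := splitProgram) (l := Sum.inl 7) rfl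
    ((((s₁.trans s₂).trans s₃).trans s₄).trans s₅)).mono (by lia)

/-! ### Polynomial-time computation on sequences of words -/

/-- The sequence of words `o a` is computable in polynomial time from the sequence `e a`. -/
def PolyTimeWords {α : Type} (e o : α → List (List Bool)) : Prop :=
  PolyTimeTapes (fun a => tapeOf (e a)) (fun a => tapeOf (o a))

theorem tapeOf_append (v w : List (List Bool)) : tapeOf (v ++ w) = tapeOf v ++ tapeOf w :=
  List.flatMap_append

theorem tapeOf_cons (w : List Bool) (ws : List (List Bool)) :
    tapeOf (w :: ws) = w.map some ++ none :: tapeOf ws := by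
  simp [tapeOf]

theorem tapeOf_nil : tapeOf [] = [] := rfl

/-- A transducer that copies the word number `i`. -/
@[reducible] def selectTransducer (i : ℕ) : Transducer where
  Q := Fin (i + 2)
  init := 0
  next q x := if x = none then (if h : q.1 < i + 1 then ⟨q.1 + 1, by lia⟩ else q) else q
  emit q x := if q.1 = i then [x] else []
  flush _ := []

/-- A transducer that ignores its input. -/
@[reducible] def constTransducer (w : List TapeSym) : Transducer where
  Q := Unit
  init := ()
  next _ _ := ()
  emit _ _ := []
  flush _ := w

/-- A transducer that joins all words and writes the result in unary. -/
@[reducible] def countTransducer : Transducer where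
  Q := Unit
  init := ()
  next _ _ := ()
  emit _ x := if x = none then [] else [some true]
  flush _ := [none]

/-- A transducer that looks up an input of length at most `N`. -/
@[reducible] noncomputable def lookupTransducer (N : ℕ) (f : List TapeSym → List TapeSym) :
    Transducer where
  Q := {l : List TapeSym // l.length ≤ N}
  finQ := (List.finite_length_le TapeSym N).fintype
  init := ⟨[], Nat.zero_le _⟩
  next q x := if h : q.1.length < N then ⟨q.1 ++ [x], by simpa using h⟩ else q
  emit _ _ := []
  flush q := f q.1

theorem constTransducer_output (w xs : List TapeSym) : (constTransducer w).output xs = w := by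
  unfold Transducer.output
  induction xs with
  | nil => rfl
  | cons x xs ih => exact ih

theorem countTransducer_output (w : List (List Bool)) :
    countTransducer.output (tapeOf w) =
      tapeOf [List.replicate (w.map List.length).sum true] := by
  have h : ∀ xs : List TapeSym, countTransducer.output xs =
      List.replicate (xs.countP Option.isSome) (some true) ++ [none] := by
    intro xs
    unfold Transducer.output
    induction xs with
    | nil => rfl
    | cons x xs ih =>
      rw [Transducer.outputFrom]
      refine (congrArg _ ih).trans ?_
      cases x <;> simp [List.replicate_succ]
  rw [h, tapeOf_cons, List.map_replicate, tapeOf_nil]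
  congr 2
  induction w with
  | nil => rfl
  | cons v w ih =>
    rw [tapeOf_cons, List.countP_append, List.countP_cons_of_neg (by simp), ih, List.map_cons,
      List.sum_cons, List.countP_map]
    congr 1
    exact List.countP_eq_length.2 (by simp)

/-- The state is the whole prefix read so far; on inputs of length at most `N` the saturating branch
is never taken. -/
theorem lookupTransducer_output (N : ℕ) (f : List TapeSym → List TapeSym) (xs : List TapeSym)
    (h : xs.length ≤ N) : (lookupTransducer N f).output xs = f xs := by
  have key : ∀ (ys zs : List TapeSym) (hy : (ys ++ zs).length ≤ N),
      (lookupTransducer N f).outputFrom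
        ⟨ys, (List.length_append ▸ Nat.le_add_right _ _ : ys.length ≤ (ys ++ zs).length).trans hy⟩
          zs = f (ys ++ zs) := by
    intro ys zs hy
    induction zs generalizing ys with
    | nil => simp [Transducer.outputFrom]
    | cons z zs ih =>
      have hlt : ys.length < N := by simp at hy; lia
      have := ih (ys ++ [z]) (by simpa using hy)
      simp only [Transducer.outputFrom, hlt, dif_pos, List.nil_append]
      rw [this]
      simp
  exact key [] xs h

theorem selectTransducer_outputFrom_map (i : ℕ) (q : Fin (i + 2)) (w : List Bool)
    (xs : List TapeSym) :
    (selectTransducer i).outputFrom q (w.map some ++ none :: xs) =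
      (if q.1 = i then w.map some ++ [none] else []) ++
        (selectTransducer i).outputFrom
          (if h : q.1 < i + 1 then ⟨q.1 + 1, by lia⟩ else q) xs := by
  induction w with
  | nil =>
    simp only [List.map_nil, List.nil_append, Transducer.outputFrom, if_true]
  | cons b w ih =>
    simp only [List.map_cons, List.cons_append, Transducer.outputFrom, reduceCtorEq, if_false]
    rw [ih]
    split <;> simp

/-- The state counts the blanks passed, capped at `i + 1`, and letters are copied only while the
count is `i`. -/
theorem selectTransducer_output (i : ℕ) (ws : List (List Bool)) :
    (selectTransducer i).output (tapeOf ws) = tapeOf ws[i]?.toList := by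
  have key : ∀ (ws : List (List Bool)) (q : Fin (i + 2)),
      (selectTransducer i).outputFrom q (tapeOf ws) =
        if q.1 ≤ i then tapeOf ws[i - q.1]?.toList else [] := by
    intro ws
    induction ws with
    | nil => intro q; simp [tapeOf_nil, Transducer.outputFrom]
    | cons w ws ih =>
      intro q
      rw [tapeOf_cons, selectTransducer_outputFrom_map]
      by_cases h₁ : q.1 = i
      · simp only [h₁, lt_add_iff_pos_right, zero_lt_one, dif_pos]
        rw [ih]
        simp [tapeOf_cons, tapeOf_nil]
      · by_cases h₂ : q.1 < i
        · rw [if_neg h₁, dif_pos (by lia), ih, if_pos (show q.1 + 1 ≤ i from h₂), if_pos h₂.le,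
            show i - q.1 = i - (q.1 + 1) + 1 by lia]
          simp
        · rw [if_neg h₁, dif_neg (by lia), ih, if_neg (by lia), if_neg (by lia)]
          rfl
  rw [Transducer.output, key]
  simp

namespace PolyTimeWords

variable {α β : Type} {e o o' : α → List (List Bool)}

theorem comap (h : PolyTimeWords e o) (f : β → α) :
    PolyTimeWords (fun b => e (f b)) (fun b => o (f b)) :=
  PolyTimeTapes.comap h f

theorem comp (h₁ : PolyTimeWords e o) (h₂ : PolyTimeWords o o') : PolyTimeWords e o' :=
  PolyTimeTapes.comp h₁ h₂

theorem append (h₁ : PolyTimeWords e o) (h₂ : PolyTimeWords e o') :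
    PolyTimeWords e (fun a => o a ++ o' a) := by
  unfold PolyTimeWords
  simp only [tapeOf_append]
  exact PolyTimeTapes.append h₁ h₂

theorem const (e : α → List (List Bool)) (w : List (List Bool)) : PolyTimeWords e fun _ => w := by
  have := PolyTimeTapes.transducer (constTransducer (tapeOf w)) (fun a => tapeOf (e a))
  simp only [constTransducer_output] at this
  exact this

theorem word (i : ℕ) {w : α → List Bool} (h : ∀ a, (e a)[i]? = some (w a)) :
    PolyTimeWords e fun a => [w a] := by
  have := PolyTimeTapes.transducer (selectTransducer i) (fun a => tapeOf (e a))
  simp only [selectTransducer_output, h, Option.toList_some] at this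
  exact this

/-- Joining words in unary is addition; it serves to add the numbers of coins of two machines. -/
theorem count (e : α → List (List Bool)) :
    PolyTimeWords e fun a => [unaryWord ((e a).map List.length).sum] := by
  have := PolyTimeTapes.transducer countTransducer (fun a => tapeOf (e a))
  simp only [countTransducer_output] at this
  exact this

/-- Table lookup. -/
theorem lookup {S : Type} [Finite S] {enc : S → List (List Bool)}
    (henc : Function.Injective fun s => tapeOf (enc s)) (g : S → List (List Bool)) :
    PolyTimeWords enc g := by
  obtain ⟨N, hN⟩ := (Set.finite_range fun s => (tapeOf (enc s)).length).bddAbove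
  -- The table is indexed by tapes, and injectivity of the encoding makes it well defined. Tapes
  -- that encode nothing get the default `[]`, which is never used.
  have := PolyTimeTapes.transducer
    (lookupTransducer N (Function.extend (fun s => tapeOf (enc s)) (fun s => tapeOf (g s))
      fun _ => []))
    (fun s => tapeOf (enc s))
  unfold PolyTimeWords
  convert this using 2 with s
  rw [lookupTransducer_output _ _ _ (hN (Set.mem_range_self s)), henc.extend_apply]

/-- This separates the coins of a refined feature map into those of the old map and those of the
distinguisher. -/
theorem split (m : α → ℕ) (r : α → List Bool) (h : ∀ a, m a ≤ (r a).length) :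
    PolyTimeWords (fun a => [unaryWord (m a), r a])
      (fun a => [(r a).take (m a), (r a).drop (m a)]) := by
  refine ⟨splitProgram.toMachine, 6 * Polynomial.X + 7, fun a => ?_⟩
  have := splitProgram_outputs (((r a).take (m a)).map some) (((r a).drop (m a)).map some ++ [none])
  have hlen : ((r a).take (m a)).length = m a := by simpa using h a
  rw [List.length_map, hlen, ← List.append_assoc, ← List.map_append, List.take_append_drop] at this
  simp only [tapeOf_cons, tapeOf_nil, unaryWord, List.map_replicate]
  refine this.mono ?_
  have := h a
  simp only [Polynomial.eval_add, Polynomial.eval_mul, Polynomial.eval_X, Polynomial.eval_ofNat]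
  simp
  lia

end PolyTimeWords

/-! ### Features -/

/-- A polynomial-time map from transcripts and coins to a finite set. -/
structure FeatureMap where
  S : Type
  [finS : Fintype S]
  enc : S → List (List Bool)
  enc_injective : Function.Injective fun s => tapeOf (enc s)
  coins : ℕ → ℕ
  coins_polyTime : PolyTimeWords (fun κ => [unaryWord κ]) (fun κ => [unaryWord (coins κ)])
  feat : (κ : ℕ) → List Bool → (Fin (coins κ) → Bool) → S
  feat_polyTime : PolyTimeWords
    (fun x : (κ : ℕ) × (List Bool × (Fin (coins κ) → Bool)) =>
      [unaryWord x.1, x.2.1, List.ofFn x.2.2])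
    (fun x => enc (feat x.1 x.2.1 x.2.2))

attribute [instance] FeatureMap.finS

theorem ofFn_castAdd_append_natAdd {α : Type} {a b : ℕ} (r : Fin (a + b) → α) :
    List.ofFn (fun i => r (Fin.castAdd b i)) ++ List.ofFn (fun i => r (Fin.natAdd a i)) =
      List.ofFn r := by
  rw [← List.ofFn_fin_append]
  congr 1
  exact Fin.append_castAdd_natAdd

namespace FeatureMap

/-- The feature map without information. -/
def trivial : FeatureMap where
  S := Unit
  enc _ := []
  enc_injective := fun _ _ _ => rfl
  coins _ := 0
  coins_polyTime := .const _ _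
  feat _ _ _ := ()
  feat_polyTime := .const _ _

/-- The forecaster that looks up the features in a table. -/
noncomputable def forecaster (Φ : FeatureMap) (g : Φ.S → Forecast) : Forecaster where
  coins := Φ.coins
  coins_polyTime := (polyTimeComputable_iff _ _ _).2 Φ.coins_polyTime
  run κ t r := g (Φ.feat κ t r)
  run_polyTime := (polyTimeComputable_iff _ _ _).2
    (Φ.feat_polyTime.comp ((PolyTimeWords.lookup Φ.enc_injective fun s => forecastWords (g s)).comap
      fun x : (κ : ℕ) × (List Bool × (Fin (Φ.coins κ) → Bool)) => Φ.feat x.1 x.2.1 x.2.2))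

variable (Φ : FeatureMap) (D : PPTM tupleWords bitWords)

/-- The features together with the decisions of a distinguisher on the possible pairs of bits. -/
def refineFeat (κ : ℕ) (t : List Bool) (r : Fin (Φ.coins κ + D.coins κ) → Bool) :
    Φ.S × (Bool → Bool → Bool) :=
  (Φ.feat κ t fun i => r (Fin.castAdd _ i), fun x y =>
    D.run κ (x, y, t, List.ofFn fun i => r (Fin.castAdd _ i)) fun i => r (Fin.natAdd _ i))

/-- The encoding of refined features. -/
def refineEnc (s : Φ.S × (Bool → Bool → Bool)) : List (List Bool) :=
  Φ.enc s.1 ++ [[s.2 false false]] ++ [[s.2 false true]] ++ [[s.2 true false]] ++ [[s.2 true true]]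

/-- The four decisions occupy a tail of fixed length on the tape, so they can be cut off from the
end even though the number of words in the encoding of the old feature is not fixed. -/
theorem refineEnc_injective : Function.Injective fun s => tapeOf (Φ.refineEnc s) := by
  rintro ⟨s, d⟩ ⟨s', d'⟩ h
  simp only [refineEnc, List.append_assoc, tapeOf_append _ ([_] ++ _)] at h
  obtain ⟨h₁, h₂⟩ := List.append_inj' h (by simp [tapeOf])
  obtain rfl := Φ.enc_injective h₁
  simp only [tapeOf, List.cons_append, List.nil_append, List.flatMap_cons, List.map_cons,
    List.map_nil, List.flatMap_nil, List.append_nil, List.cons.injEq, Option.some.injEq,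
    true_and, and_true] at h₂
  obtain ⟨h₁, h₂, h₃, h₄⟩ := h₂
  congr 1
  funext x y
  cases x <;> cases y <;> assumption

/-- After the coin string is split, the old map runs once and `D` runs four times, always on the
same coins. As the string `R`, `D` receives only the first block, the coins of the forecaster it was
chosen against. -/
theorem refineFeat_polyTime : PolyTimeWords
    (fun x : (κ : ℕ) × (List Bool × (Fin (Φ.coins κ + D.coins κ) → Bool)) =>
      [unaryWord x.1, x.2.1, List.ofFn x.2.2])
    (fun x => Φ.refineEnc (Φ.refineFeat D x.1 x.2.1 x.2.2)) := by
  let e := fun x : (κ : ℕ) × (List Bool × (Fin (Φ.coins κ + D.coins κ) → Bool)) =>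
    [unaryWord x.1, x.2.1, List.ofFn x.2.2]
  have hκ : PolyTimeWords e fun x => [unaryWord x.1] := .word 0 fun _ => rfl
  have ht : PolyTimeWords e fun x => [x.2.1] := .word 1 fun _ => rfl
  have hr : PolyTimeWords e fun x => [List.ofFn x.2.2] := .word 2 fun _ => rfl
  have hc : PolyTimeWords e fun x => [unaryWord (Φ.coins x.1)] :=
    hκ.comp (Φ.coins_polyTime.comap Sigma.fst)
  have hs : PolyTimeWords e fun x => [List.ofFn fun i => x.2.2 (Fin.castAdd _ i),
      List.ofFn fun i => x.2.2 (Fin.natAdd _ i)] := by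
    have := (hc.append hr).comp (.split
      (fun x : (κ : ℕ) × (List Bool × (Fin (Φ.coins κ + D.coins κ) → Bool)) => Φ.coins x.1)
      (fun x => List.ofFn x.2.2) fun x => by simp)
    convert this using 3 with x
    · rw [← ofFn_castAdd_append_natAdd, List.take_left' List.length_ofFn]
    · rw [← ofFn_castAdd_append_natAdd, List.drop_left' List.length_ofFn]
  have hr₁ : PolyTimeWords e fun x => [List.ofFn fun i => x.2.2 (Fin.castAdd _ i)] :=
    hs.comp (.word 0 fun _ => rfl)
  have hr₂ : PolyTimeWords e fun x => [List.ofFn fun i => x.2.2 (Fin.natAdd _ i)] :=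
    hs.comp (.word 1 fun _ => rfl)
  have hf : PolyTimeWords e fun x => Φ.enc (Φ.feat x.1 x.2.1 fun i => x.2.2 (Fin.castAdd _ i)) :=
    ((hκ.append ht).append hr₁).comp
      (Φ.feat_polyTime.comap
        fun x : (κ : ℕ) × (List Bool × (Fin (Φ.coins κ + D.coins κ) → Bool)) =>
          ⟨x.1, x.2.1, fun i => x.2.2 (Fin.castAdd _ i)⟩)
  have hd (b c : Bool) : PolyTimeWords e fun x => [[D.run x.1
      (b, c, x.2.1, List.ofFn fun i => x.2.2 (Fin.castAdd _ i))
      fun i => x.2.2 (Fin.natAdd _ i)]] := by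
    have hD : PolyTimeWords
        (fun x : (κ : ℕ) × ((Bool × Bool × List Bool × List Bool) × (Fin (D.coins κ) → Bool)) =>
          [unaryWord x.1] ++ tupleWords x.2.1 ++ [List.ofFn x.2.2])
        (fun x => bitWords (D.run x.1 x.2.1 x.2.2)) :=
      (polyTimeComputable_iff _ _ _).1 D.run_polyTime
    exact ((((hκ.append (.const e [[b], [c]])).append ht).append hr₁).append hr₂).comp
      (hD.comap
        fun x : (κ : ℕ) × (List Bool × (Fin (Φ.coins κ + D.coins κ) → Bool)) =>
          ⟨x.1, (b, c, x.2.1, List.ofFn fun i => x.2.2 (Fin.castAdd _ i)),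
        fun i => x.2.2 (Fin.natAdd _ i)⟩)
  exact (((hf.append (hd false false)).append (hd false true)).append (hd true false)).append
    (hd true true)

/-- The features together with the decisions of a distinguisher on the possible pairs of bits. -/
def refine : FeatureMap where
  S := Φ.S × (Bool → Bool → Bool)
  enc := Φ.refineEnc
  enc_injective := Φ.refineEnc_injective
  coins κ := Φ.coins κ + D.coins κ
  coins_polyTime := by
    have hD : PolyTimeWords (fun κ => [unaryWord κ]) (fun κ => [unaryWord (D.coins κ)]) :=
      (polyTimeComputable_iff _ _ _).1 D.coins_polyTime
    have := (Φ.coins_polyTime.append hD).comp (.count _)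
    simpa [unaryWord] using this
  feat := Φ.refineFeat D
  feat_polyTime := Φ.refineFeat_polyTime D

/-- The joint distribution of the features and the output bits. -/
noncomputable def joint (Φ : FeatureMap) (Z : ℕ → TripleDist) (κ : ℕ) :
    PMF (Φ.S × Bool × Bool) :=
  (Z κ).bind fun z => (uniformBits (Φ.coins κ)).map fun r => (Φ.feat κ z.2.2 r, z.1, z.2.1)

end FeatureMap

/-- Every string of length `a + b` is the concatenation of exactly one pair of blocks, and the
weights multiply. -/
theorem uniformBits_add {γ : Type} (a b : ℕ) (f : (Fin (a + b) → Bool) → γ) :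
    (uniformBits (a + b)).map f =
      (uniformBits a).bind fun r => (uniformBits b).map fun r' => f (Fin.append r r') := by
  have h : uniformBits (a + b) =
      (uniformBits a).bind fun r => (uniformBits b).map fun r' => Fin.append r r' := by
    classical
    ext w
    have key : ∀ (r : Fin a → Bool) (r' : Fin b → Bool), w = Fin.append r r' ↔
        r = (fun i => w (Fin.castAdd b i)) ∧ r' = fun i => w (Fin.natAdd a i) := by
      intro r r'
      constructor
      · rintro rfl
        simp
      · rintro ⟨rfl, rfl⟩
        exact Fin.append_castAdd_natAdd.symm
    simp only [PMF.bind_apply, PMF.map_apply, uniformBits, PMF.uniformOfFintype_apply, key,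
      tsum_fintype, ite_and]
    simp only [Finset.sum_ite_irrel, Finset.sum_const_zero, Finset.sum_ite_eq', Finset.mem_univ,
      if_true, mul_ite, mul_zero]
    simp only [Fintype.card_pi, Fintype.card_bool, Finset.prod_const, Finset.card_univ,
      Fintype.card_fin, pow_add, Nat.cast_mul]
    rw [ENNReal.mul_inv (by simp) (by simp)]
  rw [h, PMF.map_bind]
  simp only [PMF.map_comp]
  rfl

/-! ### Acceptance probabilities in terms of refined features -/

namespace FeatureMap

variable (Φ : FeatureMap) (D : PPTM tupleWords bitWords) (Z : ℕ → TripleDist) (κ : ℕ)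

/-- The joint distribution of the refined features and the output bits. -/
noncomputable def refinedJoint : PMF ((Φ.S × (Bool → Bool → Bool)) × Bool × Bool) :=
  (Z κ).bind fun z => (uniformBits (Φ.coins κ)).bind fun r =>
    (uniformBits (D.coins κ)).map fun r' =>
      ((Φ.feat κ z.2.2 r, fun x y => D.run κ (x, y, z.2.2, List.ofFn r) r'), z.1, z.2.1)

theorem joint_refine : (Φ.refine D).joint Z κ = Φ.refinedJoint D Z κ := by
  unfold joint refinedJoint
  congr 1
  funext z
  refine (uniformBits_add (Φ.coins κ) (D.coins κ) _).trans ?_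
  simp [refine, refineFeat]

/-- Forgetting the decisions of `D` integrates out its coins, so the refined law really refines the
old one. -/
theorem map_refinedJoint :
    (Φ.refinedJoint D Z κ).map (fun a => (a.1.1, a.2)) = Φ.joint Z κ := by
  simp only [PMF.map_bind, PMF.map_comp, refinedJoint, joint, Function.comp_def]
  congr 1
  funext z
  rw [← PMF.bind_pure_comp]
  congr 1
  funext r
  exact PMF.map_const _ _

/-- The refined feature contains the decision table of `D`, so acceptance on the real distribution
is this table evaluated at the true bits. -/
theorem acceptProb_realDist (g : Φ.S → Forecast) :
    acceptProb D κ (realDist Z (Φ.forecaster g) κ) =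
      (((Φ.refinedJoint D Z κ).map fun a => a.1.2 a.2.1 a.2.2) true).toReal := by
  unfold acceptProb realDist refinedJoint
  simp only [PMF.map_bind, PMF.map_comp, PMF.bind_bind, PMF.bind_map, Function.comp_def]
  rfl

/-- The same table is evaluated at bits redrawn from the forecast. These are drawn independently of
the coins of `D`, so the two draws may be exchanged. -/
theorem acceptProb_forecastDist (g : Φ.S → Forecast) :
    acceptProb D κ (forecastDist Z (Φ.forecaster g) κ) =
      (((Φ.refinedJoint D Z κ).bind fun a =>
        (biasedPair (g a.1.1)).map fun b => a.1.2 b.1 b.2) true).toReal := by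
  unfold acceptProb forecastDist refinedJoint
  simp only [PMF.bind_bind, PMF.bind_map, Function.comp_def]
  congr 3
  funext z
  congr 1
  funext r
  simp only [← PMF.bind_pure_comp, Function.comp_def]
  exact PMF.bind_comm _ _ _

end FeatureMap

/-! ### Energy -/

section Energy

variable {S Δ B : Type} [Fintype S] [Fintype Δ] [Fintype B]

/-- The expected sum of the squares of the conditional probabilities of the second component, given
the first. -/
noncomputable def energy (p : S × B → ℝ) : ℝ :=
  ∑ s, ∑ b, p (s, b) ^ 2 / ∑ b', p (s, b')

theorem energy_nonneg {p : S × B → ℝ} (hp : ∀ a, 0 ≤ p a) : 0 ≤ energy p :=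
  Finset.sum_nonneg fun _ _ => Finset.sum_nonneg fun _ _ =>
    div_nonneg (sq_nonneg _) (Finset.sum_nonneg fun _ _ => hp _)

/-- Each mass is at most the mass of its feature, so the term `p (s, b) ^ 2 / ∑ b', p (s, b')` is at
most `p (s, b)`. -/
theorem energy_le_one {p : S × B → ℝ} (hp : ∀ a, 0 ≤ p a) (h1 : ∑ a, p a = 1) : energy p ≤ 1 := by
  rw [← h1, Fintype.sum_prod_type]
  refine Finset.sum_le_sum fun s _ => Finset.sum_le_sum fun b _ => ?_
  have hle : p (s, b) ≤ ∑ b', p (s, b') :=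
    Finset.single_le_sum (f := fun b => p (s, b)) (fun _ _ => hp _) (Finset.mem_univ b)
  refine div_le_of_le_mul₀ ((hp _).trans hle) (hp _) ?_
  rw [sq]
  exact mul_le_mul_of_nonneg_left hle (hp _)

/-- The variance of the conditional probabilities under a refinement is the gain of energy. -/
theorem sum_sub_sq_div {q : Δ → B → ℝ} (hq : ∀ d b, 0 ≤ q d b) :
    ∑ d, ∑ b, (q d b - (∑ b', q d b') * ((∑ d', q d' b) / ∑ d', ∑ b', q d' b')) ^ 2 /
        ∑ b', q d b' =
      (∑ d, ∑ b, q d b ^ 2 / ∑ b', q d b') -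
        ∑ b, (∑ d, q d b) ^ 2 / ∑ b', ∑ d, q d b' := by
  set W := ∑ d', ∑ b', q d' b' with hW
  have hW' : ∑ b', ∑ d, q d b' = W := Finset.sum_comm
  have h : ∀ d b, (q d b - (∑ b', q d b') * ((∑ d', q d' b) / W)) ^ 2 / ∑ b', q d b' =
      q d b ^ 2 / (∑ b', q d b') - 2 * q d b * ((∑ d', q d' b) / W) +
        (∑ b', q d b') * ((∑ d', q d' b) / W) ^ 2 := by
    intro d b
    -- If a refined feature has no mass, its individual masses vanish as well, and with `x / 0 = 0`
    -- both sides are zero.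
    by_cases hw : ∑ b', q d b' = 0
    · have : q d b = 0 := (Finset.sum_eq_zero_iff_of_nonneg fun _ _ => hq _ _).1 hw b (Finset.mem_univ b)
      rw [hw, this]
      simp
    · field_simp
      ring
  simp only [h, Finset.sum_add_distrib, Finset.sum_sub_distrib]
  rw [hW', sub_add, sub_right_inj, Finset.sum_comm (f := fun d b => 2 * q d b * _),
    Finset.sum_comm (f := fun d b => (∑ b', q d b') * _), ← Finset.sum_sub_distrib]
  refine Finset.sum_congr rfl fun b _ => ?_
  rw [← Finset.sum_mul, ← Finset.sum_mul, ← Finset.mul_sum, ← hW]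
  by_cases hw : W = 0
  · simp [hw]
  · field_simp
    ring

/-- If forecasts close to the conditional probabilities are distinguished by tests that are part of
the refined features, then the refined features have more energy. -/
theorem energy_increment {q : (S × Δ) × B → ℝ} (hq : ∀ a, 0 ≤ q a) (h1 : ∑ a, q a = 1)
    {m : S × B → ℝ} (hm : ∀ s b, m (s, b) = ∑ d, q ((s, d), b)) {f : S → B → ℝ} {δ : ℝ}
    (hf : ∀ s b, |m (s, b) - (∑ b', m (s, b')) * f s b| ≤ δ * ∑ b', m (s, b'))
    {t : Δ → B → ℝ} (ht0 : ∀ d b, 0 ≤ t d b) (ht1 : ∀ d b, t d b ≤ 1) {ε : ℝ} (hε : 0 ≤ ε)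
    (hgap : ε + Fintype.card B * δ ≤ |(∑ s, ∑ d, ∑ b, q ((s, d), b) * t d b) -
      ∑ s, ∑ d, (∑ b', q ((s, d), b')) * ∑ b, f s b * t d b|) :
    energy m + ε ^ 2 / Fintype.card B ≤ energy q := by
  set w : S → Δ → ℝ := fun s d => ∑ b', q ((s, d), b') with hw
  have hw0 : ∀ s d, 0 ≤ w s d := fun s d => Finset.sum_nonneg fun _ _ => hq _
  have hws : ∑ s, ∑ d, w s d = 1 := by
    rw [← h1, Fintype.sum_prod_type, Fintype.sum_prod_type]
  have hWm : ∀ s, ∑ b', m (s, b') = ∑ d, w s d := by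
    intro s
    simp only [hm, hw]
    exact Finset.sum_comm
  set p : S → B → ℝ := fun s b => m (s, b) / ∑ b', m (s, b') with hp
  have hm0 : ∀ s b, 0 ≤ m (s, b) := fun s b => by
    rw [hm]; exact Finset.sum_nonneg fun _ _ => hq _
  -- Here `p` is the conditional law given the coarse feature. Multiplying by `w s d` makes its junk
  -- value on features of mass zero harmless.
  have hpf : ∀ s d b, |w s d * (p s b - f s b)| ≤ w s d * δ := by
    intro s d b
    by_cases h : ∑ b', m (s, b') = 0
    · have : w s d = 0 := by
        rw [hWm] at h
        exact (Finset.sum_eq_zero_iff_of_nonneg fun _ _ => hw0 _ _).1 h d (Finset.mem_univ d)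
      simp [this]
    · rw [abs_mul, abs_of_nonneg (hw0 s d)]
      refine mul_le_mul_of_nonneg_left ?_ (hw0 s d)
      have hpos : 0 < ∑ b', m (s, b') :=
        lt_of_le_of_ne (Finset.sum_nonneg fun _ _ => hm0 _ _) (Ne.symm h)
      have h2 := hf s b
      have h3 : m (s, b) - (∑ b', m (s, b')) * f s b = (∑ b', m (s, b')) * (p s b - f s b) := by
        simp only [hp]
        field_simp
      rw [h3, abs_mul, abs_of_pos hpos, mul_comm δ] at h2
      exact le_of_mul_le_mul_left h2 hpos
  -- The gap is the deviation of the refined law from the coarse conditional law plus the rounding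
  -- error of `f`. The second part costs at most `Fintype.card B * δ`, so the first must be at least
  -- `ε`.
  have hsplit : (∑ s, ∑ d, ∑ b, q ((s, d), b) * t d b) -
      ∑ s, ∑ d, w s d * ∑ b, f s b * t d b =
      (∑ s, ∑ d, ∑ b, (q ((s, d), b) - w s d * p s b) * t d b) +
        ∑ s, ∑ d, ∑ b, (w s d * (p s b - f s b)) * t d b := by
    simp only [← Finset.sum_add_distrib, ← Finset.sum_sub_distrib, Finset.mul_sum]
    refine Finset.sum_congr rfl fun s _ => Finset.sum_congr rfl fun d _ =>
      Finset.sum_congr rfl fun b _ => ?_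
    ring
  have habs : ∀ x y : ℝ, 0 ≤ y → y ≤ 1 → |x * y| ≤ |x| := fun x y hy0 hy1 => by
    rw [abs_mul, abs_of_nonneg hy0]
    exact mul_le_of_le_one_right (abs_nonneg _) hy1
  have hsecond : |∑ s, ∑ d, ∑ b, (w s d * (p s b - f s b)) * t d b| ≤ Fintype.card B * δ := by
    calc |∑ s, ∑ d, ∑ b, (w s d * (p s b - f s b)) * t d b|
        ≤ ∑ s, ∑ d, ∑ b : B, w s d * δ := by
          refine (Finset.abs_sum_le_sum_abs _ _).trans (Finset.sum_le_sum fun s _ => ?_)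
          refine (Finset.abs_sum_le_sum_abs _ _).trans (Finset.sum_le_sum fun d _ => ?_)
          refine (Finset.abs_sum_le_sum_abs _ _).trans (Finset.sum_le_sum fun b _ => ?_)
          exact (habs _ _ (ht0 d b) (ht1 d b)).trans (hpf s d b)
      _ = Fintype.card B * δ := by
          simp only [Finset.sum_const, Finset.card_univ, nsmul_eq_mul, ← Finset.mul_sum,
            ← Finset.sum_mul, hws, one_mul]
  have hfirst : ε ≤ ∑ a : (S × Δ) × B, |q a - w a.1.1 a.1.2 * p a.1.1 a.2| := by
    have h2 : |∑ s, ∑ d, ∑ b, (q ((s, d), b) - w s d * p s b) * t d b| ≤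
        ∑ a : (S × Δ) × B, |q a - w a.1.1 a.1.2 * p a.1.1 a.2| := by
      rw [Fintype.sum_prod_type, Fintype.sum_prod_type]
      refine (Finset.abs_sum_le_sum_abs _ _).trans (Finset.sum_le_sum fun s _ => ?_)
      refine (Finset.abs_sum_le_sum_abs _ _).trans (Finset.sum_le_sum fun d _ => ?_)
      refine (Finset.abs_sum_le_sum_abs _ _).trans (Finset.sum_le_sum fun b _ => ?_)
      exact habs _ _ (ht0 d b) (ht1 d b)
    rw [hsplit] at hgap
    have := abs_add_le (∑ s, ∑ d, ∑ b, (q ((s, d), b) - w s d * p s b) * t d b)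
      (∑ s, ∑ d, ∑ b, (w s d * (p s b - f s b)) * t d b)
    linarith
  -- Cauchy–Schwarz with weights `w` turns the `ℓ¹` deviation into a variance. The weights are
  -- summed over `b` too, so their total is `Fintype.card B`; this is the denominator in the
  -- conclusion.
  have hcs : (∑ a : (S × Δ) × B, |q a - w a.1.1 a.1.2 * p a.1.1 a.2|) ^ 2 ≤
      (∑ a : (S × Δ) × B, w a.1.1 a.1.2) *
        ∑ a : (S × Δ) × B, (q a - w a.1.1 a.1.2 * p a.1.1 a.2) ^ 2 / w a.1.1 a.1.2 := by
    refine Finset.sum_sq_le_sum_mul_sum_of_sq_le_mul _ (fun a _ => hw0 _ _)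
      (fun a _ => div_nonneg (sq_nonneg _) (hw0 _ _)) fun a _ => le_of_eq ?_
    rw [sq_abs]
    by_cases h : w a.1.1 a.1.2 = 0
    · have : q a = 0 := (Finset.sum_eq_zero_iff_of_nonneg fun _ _ => hq _).1 h a.2
        (Finset.mem_univ _)
      rw [h, this]
      simp
    · field_simp
  have hcard : ∑ a : (S × Δ) × B, w a.1.1 a.1.2 = Fintype.card B := by
    rw [Fintype.sum_prod_type, Fintype.sum_prod_type]
    simp only [Finset.sum_const, Finset.card_univ, nsmul_eq_mul, ← Finset.mul_sum, hws, mul_one]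
  -- The variance identity is applied separately to each coarse feature `s`.
  have hgain : ∑ a : (S × Δ) × B, (q a - w a.1.1 a.1.2 * p a.1.1 a.2) ^ 2 / w a.1.1 a.1.2 =
      energy q - energy m := by
    rw [Fintype.sum_prod_type, Fintype.sum_prod_type, energy, energy, Fintype.sum_prod_type,
      ← Finset.sum_sub_distrib]
    refine Finset.sum_congr rfl fun s _ => ?_
    have := sum_sub_sq_div (q := fun d b => q ((s, d), b)) fun _ _ => hq _
    rw [Finset.sum_comm (f := fun d b => q ((s, d), b))] at this
    simpa only [hp, hm, hw] using this
  rw [hcard, hgain] at hcs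
  have hsq := pow_le_pow_left₀ hε hfirst 2
  rcases (Nat.cast_nonneg (α := ℝ) (Fintype.card B)).eq_or_lt with h | h
  · have : IsEmpty B := by
      rw [← Fintype.card_eq_zero_iff]
      exact_mod_cast h.symm
    simp at h1
  · have : ε ^ 2 / Fintype.card B ≤ energy q - energy m := by
      rw [div_le_iff₀ h]
      linarith
    linarith

end Energy

/-! ### Real probabilities -/

theorem toReal_bind_apply {α β : Type} [Fintype α] (p : PMF α) (k : α → PMF β) (b : β) :
    ((p.bind k) b).toReal = ∑ a, (p a).toReal * (k a b).toReal := by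
  rw [PMF.bind_apply, tsum_fintype, ENNReal.toReal_sum fun a _ =>
    ENNReal.mul_ne_top (p.apply_ne_top a) ((k a).apply_ne_top b)]
  simp only [ENNReal.toReal_mul]

theorem toReal_map_apply {α β : Type} [Fintype α] [DecidableEq β] (p : PMF α) (f : α → β) (b : β) :
    ((p.map f) b).toReal = ∑ a, (p a).toReal * if f a = b then 1 else 0 := by
  rw [← PMF.bind_pure_comp, toReal_bind_apply]
  refine Finset.sum_congr rfl fun a _ => ?_
  simp only [Function.comp_apply, PMF.pure_apply, eq_comm (a := b)]
  split <;> simp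

theorem sum_toReal {α : Type} [Fintype α] (p : PMF α) : ∑ a, (p a).toReal = 1 := by
  rw [← ENNReal.toReal_sum fun a _ => p.apply_ne_top a, ← tsum_fintype (L := .unconditional α), p.tsum_coe,
    ENNReal.toReal_one]

/-- The probability that a bit with bias `p` equals `b`. -/
def bitProb (p : ℝ) (b : Bool) : ℝ := if b then p else 1 - p

theorem toReal_biasedBit (p : Set.Icc (0 : ℚ) 1) (b : Bool) :
    (biasedBit p b).toReal = bitProb ((p.1 : ℚ) : ℝ) b := by
  have h0 : (0 : ℝ) ≤ ((p.1 : ℚ) : ℝ) := by exact_mod_cast p.2.1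
  have h1 : ENNReal.ofReal ((p.1 : ℚ) : ℝ) ≤ 1 :=
    ENNReal.ofReal_le_one.2 (by exact_mod_cast p.2.2)
  cases b
  · simp [biasedBit, bitProb, ENNReal.toReal_sub_of_le h1, h0]
  · simp [biasedBit, bitProb, h0]

theorem toReal_biasedPair (p : Forecast) (x y : Bool) :
    (biasedPair p (x, y)).toReal = bitProb ((p.1.1 : ℚ) : ℝ) x *
      bitProb (((if x then p.2.2 else p.2.1 : Set.Icc (0 : ℚ) 1).1 : ℚ) : ℝ) y := by
  simp only [biasedPair, toReal_bind_apply, toReal_map_apply, toReal_biasedBit]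
  cases x <;> cases y <;> simp

theorem bitProb_nonneg {p : ℝ} (h0 : 0 ≤ p) (h1 : p ≤ 1) (b : Bool) : 0 ≤ bitProb p b := by
  unfold bitProb
  split <;> linarith

theorem bitProb_le_one {p : ℝ} (h0 : 0 ≤ p) (h1 : p ≤ 1) (b : Bool) : bitProb p b ≤ 1 := by
  unfold bitProb
  split <;> linarith

theorem abs_bitProb_sub (p p' : ℝ) (b : Bool) : |bitProb p b - bitProb p' b| = |p - p'| := by
  unfold bitProb
  split
  · rfl
  · rw [← abs_neg]
    congr 1
    ring

/-! ### Forecasts on a grid -/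

/-- The numbers `i / N` in the unit interval. -/
def gridPoint (N : ℕ) (i : Fin (N + 1)) : Set.Icc (0 : ℚ) 1 :=
  ⟨i / N, by positivity, div_le_one_of_le₀ (by exact_mod_cast Nat.lt_succ_iff.1 i.2) (by positivity)⟩

/-- Forecasts with coordinates on a grid. -/
def gridForecast (N : ℕ) (i : Fin (N + 1) × Fin (N + 1) × Fin (N + 1)) : Forecast :=
  (gridPoint N i.1, gridPoint N i.2.1, gridPoint N i.2.2)

theorem exists_gridPoint {N : ℕ} (hN : 0 < N) {x : ℝ} (h0 : 0 ≤ x) (h1 : x ≤ 1) :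
    ∃ i, |x - ((gridPoint N i).1 : ℚ)| ≤ 1 / N := by
  have hN' : (0 : ℝ) < N := by exact_mod_cast hN
  have hle : ⌊x * N⌋₊ ≤ N := Nat.floor_le_of_le (by nlinarith)
  refine ⟨⟨⌊x * N⌋₊, Nat.lt_succ_of_le hle⟩, ?_⟩
  have hl := Nat.floor_le (mul_nonneg h0 hN'.le)
  have hu := Nat.lt_floor_add_one (x * N)
  have : x - (((gridPoint N ⟨⌊x * N⌋₊, Nat.lt_succ_of_le hle⟩).1 : ℚ) : ℝ) =
      (x * N - ⌊x * N⌋₊) / N := by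
    simp only [gridPoint]
    push_cast
    field_simp
  rw [this, abs_of_nonneg (div_nonneg (by linarith) hN'.le)]
  exact div_le_div_of_nonneg_right (by linarith) hN'.le

/-- The conditional probabilities of the two bits are approximated by a forecast on the grid. -/
theorem exists_gridForecast {N : ℕ} (hN : 0 < N) {m : Bool × Bool → ℝ} (hm : ∀ b, 0 ≤ m b) :
    ∃ i, ∀ b, |m b - (∑ b', m b') * (biasedPair (gridForecast N i) b).toReal| ≤
      2 / N * ∑ b', m b' := by
  have hdiv : ∀ a b : ℝ, 0 ≤ a → 0 ≤ b → 0 ≤ b / (a + b) ∧ b / (a + b) ≤ 1 := fun a b ha hb =>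
    ⟨by positivity, div_le_one_of_le₀ (by linarith) (by linarith)⟩
  -- The case of total mass zero is included: both masses vanish, so any bias is correct.
  have hbit : ∀ a b : ℝ, 0 ≤ a → 0 ≤ b → ∀ y : Bool,
      (if y then b else a) = (a + b) * bitProb (b / (a + b)) y := by
    intro a b ha hb y
    unfold bitProb
    by_cases h : a + b = 0
    · have h₁ : a = 0 := by linarith
      have h₂ : b = 0 := by linarith
      simp [h₁, h₂]
    · cases y
      · simp only [Bool.false_eq_true, if_false]
        field_simp
        ring
      · simp only [if_true]
        field_simp
  set M : Bool → ℝ := fun x => m (x, false) + m (x, true) with hM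
  have hM0 : ∀ x, 0 ≤ M x := fun x => add_nonneg (hm _) (hm _)
  have hW : ∑ b', m b' = M false + M true := by
    rw [Fintype.sum_prod_type]
    simp only [Fintype.sum_bool, hM]
    ring
  set P : ℝ := M true / (M false + M true)
  set Q : Bool → ℝ := fun x => m (x, true) / (m (x, false) + m (x, true))
  have hP := hdiv _ _ (hM0 false) (hM0 true)
  have hQ : ∀ x, 0 ≤ Q x ∧ Q x ≤ 1 := fun x => hdiv _ _ (hm (x, false)) (hm (x, true))
  obtain ⟨i₁, h₁⟩ := exists_gridPoint hN hP.1 hP.2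
  obtain ⟨i₂, h₂⟩ := exists_gridPoint hN (hQ false).1 (hQ false).2
  obtain ⟨i₃, h₃⟩ := exists_gridPoint hN (hQ true).1 (hQ true).2
  refine ⟨(i₁, i₂, i₃), ?_⟩
  rintro ⟨x, y⟩
  rw [toReal_biasedPair, hW]
  set P' : ℝ := (((gridForecast N (i₁, i₂, i₃)).1.1 : ℚ) : ℝ)
  set Q' : ℝ := (((if x then (gridForecast N (i₁, i₂, i₃)).2.2
    else (gridForecast N (i₁, i₂, i₃)).2.1 : Set.Icc (0 : ℚ) 1).1 : ℚ) : ℝ) with hQ'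
  have hQQ : |Q x - Q'| ≤ 1 / N := by
    cases x
    · simpa [hQ', gridForecast] using h₂
    · simpa [hQ', gridForecast] using h₃
  have hP'0 : 0 ≤ P' := Rat.cast_nonneg.2 (gridForecast N (i₁, i₂, i₃)).1.2.1
  have hP'1 : P' ≤ 1 :=
    (Rat.cast_le.2 (gridForecast N (i₁, i₂, i₃)).1.2.2).trans_eq Rat.cast_one
  have hmx : m (x, y) = (M false + M true) * bitProb P x * bitProb (Q x) y := by
    rw [← hbit _ _ (hM0 false) (hM0 true) x]
    have h := hbit _ _ (hm (x, false)) (hm (x, true)) y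
    have e₁ : (if x then M true else M false) = M x := by cases x <;> rfl
    have e₂ : (if y then m (x, true) else m (x, false)) = m (x, y) := by cases y <;> rfl
    rw [e₁, ← e₂, h]
  -- Exchanging one factor at a time costs `1 / N` for each of the two bits.
  have hbound : |bitProb P x * bitProb (Q x) y - bitProb P' x * bitProb Q' y| ≤ 2 / N := by
    have e : bitProb P x * bitProb (Q x) y - bitProb P' x * bitProb Q' y =
        (bitProb P x - bitProb P' x) * bitProb (Q x) y +
          bitProb P' x * (bitProb (Q x) y - bitProb Q' y) := by ring
    rw [e]
    refine (abs_add_le _ _).trans ?_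
    rw [abs_mul, abs_mul, abs_bitProb_sub, abs_bitProb_sub,
      abs_of_nonneg (bitProb_nonneg (hQ x).1 (hQ x).2 y), abs_of_nonneg (bitProb_nonneg hP'0 hP'1 x)]
    have b₁ := mul_le_of_le_one_right (abs_nonneg (P - P')) (bitProb_le_one (hQ x).1 (hQ x).2 y)
    have b₂ := mul_le_of_le_one_left (abs_nonneg (Q x - Q')) (bitProb_le_one hP'0 hP'1 x)
    have b₃ : |P - P'| ≤ 1 / N := h₁
    have : (2 : ℝ) / N = 1 / N + 1 / N := by ring
    linarith
  have e : m (x, y) - (M false + M true) * (bitProb P' x * bitProb Q' y) =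
      (M false + M true) * (bitProb P x * bitProb (Q x) y - bitProb P' x * bitProb Q' y) := by
    rw [hmx]
    ring
  have hWn : 0 ≤ M false + M true := add_nonneg (hM0 _) (hM0 _)
  rw [e, abs_mul, abs_of_nonneg hWn, mul_comm (2 / (N : ℝ))]
  exact mul_le_mul_of_nonneg_left hbound hWn

/-! ### Energy of features -/

namespace FeatureMap

variable (Φ : FeatureMap) (D : PPTM tupleWords bitWords) (Z : ℕ → TripleDist) (κ : ℕ)

/-- The energy of the features. -/
noncomputable def energy : ℝ := _root_.energy fun a => (Φ.joint Z κ a).toReal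

theorem energy_nonneg : 0 ≤ Φ.energy Z κ := _root_.energy_nonneg fun _ => ENNReal.toReal_nonneg

theorem energy_le_one : Φ.energy Z κ ≤ 1 :=
  _root_.energy_le_one (fun _ => ENNReal.toReal_nonneg) (sum_toReal _)

/-- This is `energy_increment` with the four pairs of bits as `B` and with evaluation of the
recorded decision table as the test; both occurrences of 4 are the number of pairs. -/
theorem energy_refine {g : Φ.S → Forecast} {δ ε : ℝ} (hε : 0 ≤ ε)
    (hg : ∀ s b, |(Φ.joint Z κ (s, b)).toReal -
      (∑ b', (Φ.joint Z κ (s, b')).toReal) * (biasedPair (g s) b).toReal| ≤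
        δ * ∑ b', (Φ.joint Z κ (s, b')).toReal)
    (hgap : ε + 4 * δ ≤ |acceptProb D κ (realDist Z (Φ.forecaster g) κ) -
      acceptProb D κ (forecastDist Z (Φ.forecaster g) κ)|) :
    Φ.energy Z κ + ε ^ 2 / 4 ≤ (Φ.refine D).energy Z κ := by
  classical
  set q : (Φ.S × (Bool → Bool → Bool)) × Bool × Bool → ℝ :=
    fun a => (Φ.refinedJoint D Z κ a).toReal with hq
  have henergy : (Φ.refine D).energy Z κ = _root_.energy q := by
    unfold energy
    rw [joint_refine]
    rfl
  have hcard : ((Fintype.card (Bool × Bool) : ℕ) : ℝ) = 4 := by norm_num [Fintype.card_prod]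
  have hmarg : ∀ s b, (Φ.joint Z κ (s, b)).toReal = ∑ d, q ((s, d), b) := by
    intro s b
    rw [← Φ.map_refinedJoint D, toReal_map_apply, Fintype.sum_prod_type, Fintype.sum_prod_type,
      Finset.sum_comm]
    refine Finset.sum_congr rfl fun d _ => ?_
    simp only [Prod.mk.injEq, ite_and, mul_ite, mul_one, mul_zero]
    simp [hq]
  rw [henergy]
  have := energy_increment (q := q) (fun _ => ENNReal.toReal_nonneg) (sum_toReal _)
    (m := fun a => (Φ.joint Z κ a).toReal) hmarg
    (f := fun s b => (biasedPair (g s) b).toReal) hg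
    (t := fun d b => if d b.1 b.2 = true then 1 else 0)
    (fun d b => by split <;> norm_num) (fun d b => by split <;> norm_num) hε
    (by
      rw [hcard]
      refine hgap.trans_eq ?_
      rw [acceptProb_realDist, acceptProb_forecastDist, toReal_map_apply, toReal_bind_apply]
      simp only [toReal_map_apply]
      rw [Fintype.sum_prod_type, Fintype.sum_prod_type, Fintype.sum_prod_type (α₁ := Φ.S × _),
        Fintype.sum_prod_type (α₁ := Φ.S)]
      simp only [hq, Finset.sum_mul])
  rw [hcard] at this
  exact this

end FeatureMap

/-! ### The forecaster -/

/-- Pigeonhole; it is applied to the map sending `κ` to its table of rounded forecasts. -/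
theorem exists_infinite_fiber_of_infinite {α β : Type} [Finite β] {I : Set α} (hI : I.Infinite)
    (f : α → β) : ∃ b, (I ∩ f ⁻¹' {b}).Infinite := by
  by_contra! h
  refine hI ((Set.finite_iUnion fun b => h b).subset fun a ha => ?_)
  exact Set.mem_iUnion.2 ⟨f a, ha, rfl⟩

theorem exists_indistinguishable_forecaster (Z : ℕ → TripleDist) {ρ : ℝ} (hρ : 0 < ρ) {I : Set ℕ}
    (hI : I.Infinite) :
    ∃ (F : Forecaster) (I' : Set ℕ), I' ⊆ I ∧ I'.Infinite ∧ F.Indistinguishable ρ I' Z := by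
  by_contra! hcon
  obtain ⟨N, hN⟩ := exists_nat_gt (16 / ρ)
  have hN0 : (0 : ℝ) < N := lt_trans (by positivity) hN
  -- The grid is so fine that rounding costs at most half of the advantage `ρ`; the other half is
  -- the `ε` of the increment, so each round gains `(ρ / 2) ^ 2 / 4`.
  have hNρ : ρ / 2 + 4 * (2 / N) ≤ ρ := by
    have : 16 / N < ρ := by
      rw [div_lt_iff₀ hρ] at hN
      rw [div_lt_iff₀ hN0]
      linarith
    have e : 4 * (2 / (N : ℝ)) = 16 / N / 2 := by ring
    rw [e]
    linarith
  -- The energy bound is claimed for every `κ` in the current infinite set, so in the end a single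
  -- `κ` gives the contradiction.
  have step : ∀ n : ℕ, ∃ (Φ : FeatureMap) (I' : Set ℕ), I' ⊆ I ∧ I'.Infinite ∧
      ∀ κ ∈ I', n * ((ρ / 2) ^ 2 / 4) ≤ Φ.energy Z κ := by
    intro n
    induction n with
    | zero =>
      exact ⟨.trivial, I, subset_rfl, hI, fun κ _ => by
        simpa using FeatureMap.energy_nonneg _ _ _⟩
    | succ n ih =>
      obtain ⟨Φ, J, hJI, hJ, hΦ⟩ := ih
      choose i hi using fun κ s => exists_gridForecast (N := N) (by exact_mod_cast hN0)
        (m := fun b => (Φ.joint Z κ (s, b)).toReal) fun _ => ENNReal.toReal_nonneg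
      -- The table `i κ` takes values in a finite type of functions. On the infinite fibre it equals
      -- the constant `j`, which a uniform machine can contain.
      obtain ⟨j, hj⟩ := exists_infinite_fiber_of_infinite hJ i
      have hD := hcon (Φ.forecaster fun s => gridForecast N (j s)) (J ∩ i ⁻¹' {j})
        (Set.inter_subset_left.trans hJI) hj
      unfold Forecaster.Indistinguishable IndistinguishableIn at hD
      push Not at hD
      obtain ⟨D, hD⟩ := hD
      refine ⟨Φ.refine D, {κ ∈ J ∩ i ⁻¹' {j} |
        ρ < |acceptProb D κ (realDist Z (Φ.forecaster fun s => gridForecast N (j s)) κ) -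
          acceptProb D κ (forecastDist Z (Φ.forecaster fun s => gridForecast N (j s)) κ)|},
        fun κ hκ => hJI hκ.1.1, ?_, ?_⟩
      · refine Set.infinite_of_forall_exists_gt fun κ₀ => ?_
        -- The threshold `κ₀ + 1` yields the strict inequality `κ₀ < κ` required for infinitude.
        obtain ⟨κ, hκ, hle, hlt⟩ := hD (κ₀ + 1)
        exact ⟨κ, ⟨hκ, hlt⟩, hle⟩
      · rintro κ ⟨⟨hκJ, hκ⟩, hlt⟩
        have hκ' : i κ = j := hκ
        have := Φ.energy_refine D Z κ (g := fun s => gridForecast N (j s)) (δ := 2 / N)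
          (ε := ρ / 2) (by positivity) (by rw [← hκ']; exact hi κ) (hNρ.trans hlt.le)
        have := hΦ κ hκJ
        push_cast
        linarith
  obtain ⟨n, hn⟩ := exists_nat_gt (1 / ((ρ / 2) ^ 2 / 4))
  obtain ⟨Φ, J, -, hJ, hΦ⟩ := step n
  obtain ⟨κ, hκ⟩ := hJ.nonempty
  have h₁ := (hΦ κ hκ).trans (Φ.energy_le_one Z κ)
  rw [div_lt_iff₀ (by positivity)] at hn
  linarith

theorem theorem3p4 :
    (∀ Z : ℕ → TripleDist, (∀ κ, (Z κ).support.Finite) →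
      ∀ ρ : ℝ, 0 < ρ → ∀ I : Set ℕ, I.Infinite →
        ∃ (F : Forecaster) (I' : Set ℕ), I' ⊆ I ∧ I'.Infinite ∧ F.Indistinguishable ρ I' Z) ∧
    (∀ π : Protocol, ∀ ρ : ℝ, 0 < ρ → ∀ I : Set ℕ, I.Infinite →
        ∃ (F : Forecaster) (I' : Set ℕ),
          I' ⊆ I ∧ I'.Infinite ∧ F.Indistinguishable ρ I' π.outputDist) :=
  ⟨fun Z _ _ hρ _ hI => exists_indistinguishable_forecaster Z hρ hI,
    fun π _ hρ _ hI => exists_indistinguishable_forecaster π.outputDist hρ hI⟩
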